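/- **Choi state of measuring two stabilizer groups.** A Pauli unitary on $n$ qubits is an operator $i^kP_1\otimes\cdots\otimes P_n$ with $P_j\in\{I,X,Y,Z\}$; it is a Pauli observable if the scalar is $\pm1$. A stabilizer group is a group of commuting Pauli observables that does not contain $-I$. Let $S$ and $M$ be stabilizer groups on $n$ qubits with a common symplectic basis $\mathcal B$: $2n$ Pauli unitaries in ten ordered sets $\mathcal Z_\Delta,\mathcal X_\Delta,\mathcal Z_\cap,\mathcal X_\cap,\mathcal Z_S,\mathcal X_S,\mathcal Z_M,\mathcal X_M,\mathcal Z,\mathcal X$, where the two sets with the same subscript (and likewise $\mathcal Z$ and $\mathcal X$) have the same size, the $j$-th elements of these two sets anticommute, all other pairs of elements of $\mathcal B$ commute, and $$S=\langle \mathcal Z_\Delta\cup\mathcal Z_\cap\cup\mathcal Z_S\rangle,\qquad M=\langle \mathcal X_\Delta\cup\mathcal Z_\cap\cup\mathcal Z_M\rangle .$$ Let $\mathcal S_{\mathcal B}$ be the circuit that (non-destructively) measures $\mathcal Z_\Delta,\mathcal Z_\cap,\mathcal Z_S$, with outcome vector $v_S$. Let $\mathcal M_{\mathcal B}$ be the circuit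 that measures $\mathcal X_\Delta,\mathcal Z_\cap,\mathcal Z_M$, with outcome vector $v_M$, then applies $(\mathcal Z_\Delta)_j$ for each $j$ with $v_M((\mathcal X_\Delta)_j)=1$, and then applies $(\mathcal X_M)_j$ for each $j$ with $v_M((\mathcal Z_M)_j)=1$. Let $\mathcal S_{\mathcal B}\circ\mathcal M_{\mathcal B}$ be the circuit that executes first $\mathcal S_{\mathcal B}$ and then $\mathcal M_{\mathcal B}$; let $Q_v$ be the linear map that it enacts upon outcome $v=v_S\oplus v_M$ (where measuring $P$ with outcome $b$ enacts $(I+(-1)^bP)/2$), so that its action upon outcome $v$ is $\rho\mapsto Q_v\rho Q_v^\dagger$. Its Choi state upon outcome $v$ is the vector $(Q_v\otimes I)\,2^{-n/2}\sum_{k\in\{0,1\}^n}|k\rangle\otimes|k\rangle$, up to normalization. 1. For every outcome $v=v_S\oplus v_M$ that can occur ($Q_v\neq0$), the group of all Pauli observables on $2n$ qubits of which the Choi state is a $+1$ eigenvector is generated by $$\begin{array}{rcll} P&\otimes&(-1)^{v_S(P)}I, & P\in\mathcal Z_\cap\cup\mathcal Z_S\quad\text{(output stabilizers)},\\ P&\otimes&I,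 & P\in\mathcal X_\Delta\cup\mathcal Z_M\quad\text{(output stabilizers)},\\ I&\otimes&(-1)^{v_S(P)}P^*, & P\in\mathcal Z_\Delta\cup\mathcal Z_\cap\cup\mathcal Z_S\quad\text{(measured observables)},\\ I&\otimes&(-1)^{v_M(P)}P^*, & P\in\mathcal Z_M\quad\text{(measured observables)},\\ P&\otimes&P^*, & P\in\mathcal X\cup\mathcal Z\quad\text{(preserved observables)}, \end{array}$$ where $P^*$ is the entrywise complex conjugate of $P$ in the computational basis. 2. Neither the action $\rho\mapsto Q_v\rho Q_v^\dagger$ of the circuit nor the signs of these generators (nor the set of Pauli observables that stabilize the Choi state) depend on the outcomes $v_M(P)$ for $P\in\mathcal X_\Delta$. 3. The outcomes $v_M(P)$ for $P\in\mathcal X_\Delta$ are random: for every input state and every sequence of earlier outcomes of positive probability, each of the two values of $v_M(P)$ has conditional probability $1/2$. -/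

import Mathlib

open scoped Matrix Kronecker ComplexOrder

namespace StabChoi

noncomputable section

/-! ## Pauli operators on a register of qubits labelled by a finite type -/

/-- Linear operators on the qubits labelled by `ι`, in the computational basis `ι → Fin 2`. -/
abbrev Op (ι : Type) : Type := Matrix (ι → Fin 2) (ι → Fin 2) ℂ

/-- Unitary operators on the qubits labelled by `ι`. -/
abbrev Un (ι : Type) [Fintype ι] [DecidableEq ι] : Type :=
  ↥(Matrix.unitaryGroup (ι → Fin 2) ℂ)

/-- The single-qubit Pauli matrices `I, X, Y, Z`. -/
def pauliMatrix : Fin 4 → Matrix (Fin 2) (Fin 2) ℂ :=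
  ![!![1, 0; 0, 1], !![0, 1; 1, 0], !![0, -Complex.I; Complex.I, 0], !![1, 0; 0, -1]]

/-- The tensor product `⨂ᵢ σ_{p i}` of single-qubit Pauli matrices. -/
def pauliString {ι : Type} [Fintype ι] (p : ι → Fin 4) : Op ι :=
  Matrix.of fun a b => ∏ i, pauliMatrix (p i) (a i) (b i)

/-- Pauli unitaries: `i ^ k` times a tensor product of matrices from `I, X, Y, Z`. -/
def IsPauli {ι : Type} [Fintype ι] [DecidableEq ι] (P : Un ι) : Prop :=
  ∃ (k : Fin 4) (p : ι → Fin 4), (P : Op ι) = (Complex.I ^ (k : ℕ)) • pauliString p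

/-- Pauli observables: `±` a tensor product of matrices from `I, X, Y, Z`. -/
def IsPauliObservable {ι : Type} [Fintype ι] [DecidableEq ι] (P : Un ι) : Prop :=
  ∃ p : ι → Fin 4, (P : Op ι) = pauliString p ∨ (P : Op ι) = -pauliString p

/-- A stabilizer group: a group of commuting Pauli observables that does not contain `-I`. -/
structure IsStabilizerGroup {ι : Type} [Fintype ι] [DecidableEq ι] (S : Subgroup (Un ι)) :
    Prop where
  observable : ∀ P ∈ S, IsPauliObservable P
  commute : ∀ P ∈ S, ∀ Q ∈ S, P * Q = Q * P
  neg_one_notMem : (-1 : Un ι) ∉ S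

/-- All Pauli observables of which `ψ` is a `+1` eigenvector. -/
def stabilizers {ι : Type} [Fintype ι] [DecidableEq ι] (ψ : (ι → Fin 2) → ℂ) : Set (Un ι) :=
  {P | IsPauliObservable P ∧ (P : Op ι) *ᵥ ψ = ψ}

/-- The scalar operator `(-1) ^ b · I`. -/
def sgn {ι : Type} [Fintype ι] [DecidableEq ι] (b : ZMod 2) : Un ι := (-1) ^ b.val

/-- The tensor product of operators: `A` acts on the first register, `B` on the second. -/
def tensorOp {ι κ : Type} (A : Op ι) (B : Op κ) : Op (ι ⊕ κ) :=
  (A ⊗ₖ B).submatrix (Equiv.sumArrowEquivProdArrow ι κ (Fin 2))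
    (Equiv.sumArrowEquivProdArrow ι κ (Fin 2))

theorem tensorOp_mem_unitaryGroup {ι κ : Type} [Fintype ι] [DecidableEq ι] [Fintype κ]
    [DecidableEq κ] (A : Un ι) (B : Un κ) :
    tensorOp (A : Op ι) (B : Op κ) ∈ Matrix.unitaryGroup (ι ⊕ κ → Fin 2) ℂ := by
  have hA := Matrix.mem_unitaryGroup_iff.mp A.2
  have hB := Matrix.mem_unitaryGroup_iff.mp B.2
  rw [Matrix.star_eq_conjTranspose] at hA hB
  rw [Matrix.mem_unitaryGroup_iff, Matrix.star_eq_conjTranspose, tensorOp,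
    Matrix.conjTranspose_submatrix, Matrix.submatrix_mul_equiv, Matrix.conjTranspose_kronecker,
    ← Matrix.mul_kronecker_mul, hA, hB, Matrix.one_kronecker_one, Matrix.submatrix_one_equiv]

/-- The tensor product `A ⊗ B` of two unitaries. -/
def tensor {ι κ : Type} [Fintype ι] [DecidableEq ι] [Fintype κ] [DecidableEq κ]
    (A : Un ι) (B : Un κ) : Un (ι ⊕ κ) :=
  ⟨tensorOp (A : Op ι) (B : Op κ), tensorOp_mem_unitaryGroup A B⟩

theorem map_star_mem_unitaryGroup {ι : Type} [Fintype ι] [DecidableEq ι] (A : Un ι) :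
    (A : Op ι).map star ∈ Matrix.unitaryGroup (ι → Fin 2) ℂ := by
  have hA := Matrix.mem_unitaryGroup_iff.mp A.2
  have h := congrArg (fun X : Op ι => X.map star) hA
  rw [Matrix.mem_unitaryGroup_iff]
  simpa [Matrix.star_eq_conjTranspose, Matrix.conjTranspose, Matrix.map_mul,
    Function.comp_def, Matrix.transpose_map] using h

/-- The entrywise complex conjugate of a unitary. -/
def conj {ι : Type} [Fintype ι] [DecidableEq ι] (A : Un ι) : Un ι :=
  ⟨(A : Op ι).map star, map_star_mem_unitaryGroup A⟩

/-! ## Circuits of Pauli measurements and conditional Pauli unitaries -/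

/-- The two kinds of elementary stabilizer operations that are used here. Each measurement carries
a label from `L`, and its outcome is the corresponding coordinate of the outcome vector. -/
inductive StabOp (ι : Type) [Fintype ι] [DecidableEq ι] (L : Type) : Type
  /-- Non-destructive measurement of the Pauli observable `P`; the outcome is named `l`. -/
  | measure (l : L) (P : Un ι) : StabOp ι L
  /-- The Pauli unitary `P`, applied iff the parity of the outcomes named in `c` is odd. -/
  | condPauli (c : Finset L) (P : Un ι) : StabOp ι L

/-- A circuit: a list of operations, the head of the list is executed first. -/
abbrev Circuit (ι : Type) [Fintype ι] [DecidableEq ι] (L : Type) : Type := List (StabOp ι L)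

/-- The linear map enacted by one operation when the outcome vector is `v`: a measurement of `P`
enacts the projector `(I + (-1) ^ v(P) P) / 2`. -/
def StabOp.kraus {ι : Type} [Fintype ι] [DecidableEq ι] {L : Type} (v : L → ZMod 2) :
    StabOp ι L → Op ι
  | .measure l P => (1 / 2 : ℂ) • (1 + ((sgn (v l) * P : Un ι) : Op ι))
  | .condPauli c P => if ∑ l ∈ c, v l = 1 then (P : Op ι) else 1

/-- The linear map `Q_v` enacted by a circuit when the outcome vector is `v`. -/
def Circuit.kraus {ι : Type} [Fintype ι] [DecidableEq ι] {L : Type} (v : L → ZMod 2) :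
    Circuit ι L → Op ι
  | [] => 1
  | g :: C => Circuit.kraus v C * g.kraus v

/-- The completely positive map `ρ ↦ Q_v ρ Q_v†`: the action of the circuit upon outcome `v`. -/
def Circuit.action {ι : Type} [Fintype ι] [DecidableEq ι] {L : Type} (C : Circuit ι L)
    (v : L → ZMod 2) (ρ : Op ι) : Op ι :=
  Circuit.kraus v C * ρ * (Circuit.kraus v C)ᴴ

/-- The probability that the outcomes in the circuit are as prescribed by `v`, on input `ρ`. -/
def Circuit.prob {ι : Type} [Fintype ι] [DecidableEq ι] {L : Type} (C : Circuit ι L)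
    (v : L → ZMod 2) (ρ : Op ι) : ℝ :=
  (Matrix.trace (C.action v ρ)).re

/-- Density matrices. -/
structure IsDensity {ι : Type} [Fintype ι] [DecidableEq ι] (ρ : Op ι) : Prop where
  posSemidef : ρ.PosSemidef
  trace_eq_one : Matrix.trace ρ = 1

/-- The outcome named `l` is random: it is the outcome of a measurement in the circuit, and for
every input state and every sequence of earlier outcomes of positive probability, each of its two
values has conditional probability `1 / 2`. -/
def Circuit.IsRandomOutcome {ι : Type} [Fintype ι] [DecidableEq ι] {L : Type} (C : Circuit ι L)
    (l : L) : Prop :=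
  ∃ (C₁ C₂ : Circuit ι L) (P : Un ι), C = C₁ ++ StabOp.measure l P :: C₂ ∧
    ∀ (ρ : Op ι) (v : L → ZMod 2), IsDensity ρ → Circuit.prob C₁ v ρ ≠ 0 →
      Circuit.prob (C₁ ++ [StabOp.measure l P]) v ρ / Circuit.prob C₁ v ρ = 1 / 2

/-- Renaming the outcomes of an operation. -/
def StabOp.relabel {ι : Type} [Fintype ι] [DecidableEq ι] {L L' : Type} (f : L ↪ L') :
    StabOp ι L → StabOp ι L'
  | .measure l P => .measure (f l) P
  | .condPauli c P => .condPauli (c.map f) P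

/-- First `C₁`, then `C₂`. The outcome vector is the concatenation of the two outcome vectors. -/
def Circuit.seq {ι : Type} [Fintype ι] [DecidableEq ι] {L₁ L₂ : Type} (C₁ : Circuit ι L₁)
    (C₂ : Circuit ι L₂) : Circuit ι (L₁ ⊕ L₂) :=
  C₁.map (StabOp.relabel Function.Embedding.inl) ++
    C₂.map (StabOp.relabel Function.Embedding.inr)

/-- The Bell state `2 ^ (-n/2) ∑ₖ |k⟩ ⊗ |k⟩` of two copies of a register of `n` qubits. -/
def bell (ι : Type) [Fintype ι] [DecidableEq ι] : (ι ⊕ ι → Fin 2) → ℂ := fun a =>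
  if (fun i => a (Sum.inl i)) = fun i => a (Sum.inr i) then
    1 / ((Real.sqrt 2 : ℝ) : ℂ) ^ Fintype.card ι
  else 0

/-- The (unnormalized) state produced upon outcome `v` by the Choi circuit, that is, by applying
the circuit to the first half of the Bell state: `(Q_v ⊗ I) |Bell⟩`. -/
def Circuit.choiState {ι : Type} [Fintype ι] [DecidableEq ι] {L : Type} (C : Circuit ι L)
    (v : L → ZMod 2) : (ι ⊕ ι → Fin 2) → ℂ :=
  tensorOp (Circuit.kraus v C) (1 : Op ι) *ᵥ bell ι

/-! ## Common symplectic bases and the two circuits -/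

/-- The five blocks of a common symplectic basis; `rest` is the block of the undecorated sets
`𝒵` and `𝒳`. -/
inductive Block : Type
  | delta | cap | s | m | rest

/-- A common symplectic basis of two groups `S` and `M` of operators on `n` qubits: `2n` Pauli
unitaries in ten ordered sets, `z b` and `x b` for the five blocks `b`, such that `z b j`
anticommutes with `x b j` and all other pairs commute, with `S` generated by
`Z_Δ ∪ Z_∩ ∪ Z_S` and `M` generated by `X_Δ ∪ Z_∩ ∪ Z_M`. -/
structure CommonSymplecticBasis (n : ℕ) (S M : Subgroup (Un (Fin n))) where
  /-- the sizes of the blocks -/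
  d : Block → ℕ
  z : (b : Block) → Fin (d b) → Un (Fin n)
  x : (b : Block) → Fin (d b) → Un (Fin n)
  sum_d : d .delta + d .cap + d .s + d .m + d .rest = n
  pauli_z : ∀ b j, IsPauli (z b j)
  pauli_x : ∀ b j, IsPauli (x b j)
  comm_zz : ∀ b j b' j', z b j * z b' j' = z b' j' * z b j
  comm_xx : ∀ b j b' j', x b j * x b' j' = x b' j' * x b j
  anticomm_xz : ∀ b j, x b j * z b j = -(z b j * x b j)
  comm_xz : ∀ b j b' j', (⟨b, j⟩ : Σ b, Fin (d b)) ≠ ⟨b', j'⟩ →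
    x b j * z b' j' = z b' j' * x b j
  closure_S : Subgroup.closure
    (Set.range (z .delta) ∪ Set.range (z .cap) ∪ Set.range (z .s)) = S
  closure_M : Subgroup.closure
    (Set.range (x .delta) ∪ Set.range (z .cap) ∪ Set.range (z .m)) = M

/-- Names of the outcomes of the syndrome extraction circuit. -/
inductive LabelS (d : Block → ℕ) : Type
  | zDelta (j : Fin (d .delta))
  | zCap (j : Fin (d .cap))
  | zS (j : Fin (d .s))

/-- Names of the outcomes of the code deformation circuit. -/
inductive LabelM (d : Block → ℕ) : Type
  | xDelta (j : Fin (d .delta))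
  | zCap (j : Fin (d .cap))
  | zM (j : Fin (d .m))

variable {n : ℕ} {S M : Subgroup (Un (Fin n))}

/-- The syndrome extraction circuit: measure `Z_Δ`, `Z_∩`, `Z_S`. -/
def CommonSymplecticBasis.circuitS (B : CommonSymplecticBasis n S M) :
    Circuit (Fin n) (LabelS B.d) :=
  (List.finRange (B.d .delta)).map (fun j => .measure (.zDelta j) (B.z .delta j)) ++
  (List.finRange (B.d .cap)).map (fun j => .measure (.zCap j) (B.z .cap j)) ++
  (List.finRange (B.d .s)).map (fun j => .measure (.zS j) (B.z .s j))

/-- The symplectic-basis code deformation circuit: measure `X_Δ`, `Z_∩`, `Z_M`; then apply `Z_Δ j`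
if the outcome of `X_Δ j` is one, and `X_M j` if the outcome of `Z_M j` is one. -/
def CommonSymplecticBasis.circuitM (B : CommonSymplecticBasis n S M) :
    Circuit (Fin n) (LabelM B.d) :=
  (List.finRange (B.d .delta)).map (fun j => .measure (.xDelta j) (B.x .delta j)) ++
  (List.finRange (B.d .cap)).map (fun j => .measure (.zCap j) (B.z .cap j)) ++
  (List.finRange (B.d .m)).map (fun j => .measure (.zM j) (B.z .m j)) ++
  (List.finRange (B.d .delta)).map (fun j => .condPauli {.xDelta j} (B.z .delta j)) ++
  (List.finRange (B.d .m)).map (fun j => .condPauli {.zM j} (B.x .m j))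

/-- The circuit that executes first the syndrome extraction circuit and then the code deformation
circuit. -/
def CommonSymplecticBasis.circuitSM (B : CommonSymplecticBasis n S M) :
    Circuit (Fin n) (LabelS B.d ⊕ LabelM B.d) :=
  B.circuitS.seq B.circuitM

/-- The signed operators in the three families: output stabilizers, measured observables and
preserved observables (the output register is the first tensor factor). -/
def CommonSymplecticBasis.choiGenerators (B : CommonSymplecticBasis n S M)
    (vS : LabelS B.d → ZMod 2) (vM : LabelM B.d → ZMod 2) : Set (Un (Fin n ⊕ Fin n)) :=
  -- output stabilizers
  Set.range (fun j => tensor (B.z .cap j) (sgn (vS (.zCap j)))) ∪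
  Set.range (fun j => tensor (B.z .s j) (sgn (vS (.zS j)))) ∪
  Set.range (fun j => tensor (B.x .delta j) 1) ∪
  Set.range (fun j => tensor (B.z .m j) 1) ∪
  -- measured observables
  Set.range (fun j => tensor 1 (sgn (vS (.zDelta j)) * conj (B.z .delta j))) ∪
  Set.range (fun j => tensor 1 (sgn (vS (.zCap j)) * conj (B.z .cap j))) ∪
  Set.range (fun j => tensor 1 (sgn (vS (.zS j)) * conj (B.z .s j))) ∪
  Set.range (fun j => tensor 1 (sgn (vM (.zM j)) * conj (B.z .m j))) ∪
  -- preserved observables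
  Set.range (fun j => tensor (B.x .rest j) (conj (B.x .rest j))) ∪
  Set.range (fun j => tensor (B.z .rest j) (conj (B.z .rest j)))

end

end StabChoi

namespace StabChoi

set_option linter.unusedSectionVars false

/-! ## Signs -/

/-! Applying `A ⊗ B*` to the Choi vector of `Q` gives the Choi vector of `A Q B†`
(`tensor_conj_mulVec`). Stabilizing the Choi state is thus an identity about `Q`: output stabilizers
are Paulis absorbed by `Q` on the left, measured observables those absorbed on the right, preserved
observables those that commute with `Q`. Each identity follows by moving a basis element through the
circuit. It commutes with most factors, becomes a sign at its own measurement, and changes sign at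
the correction that anticommutes with it. For `X_Δ` and `Z_M` the last two signs cancel on the
output side.

The stabilizer group contains nothing else because the `2n` generators commute on `2n` qubits and
are independent: there is a dual family each of whose members anticommutes with exactly one
generator (`pairing_parts_dual`). By counting, words in generators and duals exhaust all Pauli
strings up to scalars, so a Pauli commuting with all generators is a scalar times a word in the
generators (`exists_smul_eq_of_commute`). A stabilizer of a nonzero vector fixed by the generators
commutes with them, and the scalar is one. Arbitrary scalars are allowed throughout, so only
commutation signs need bookkeeping.

For independence of the outcomes of `X_Δ`, the correction by `Z_Δ` turns the projector for any
outcome into that for outcome zero, and is itself absorbed as a sign, `Z_Δ` having been measured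
before (`exists_kraus_circuitSM_eq_smul`). These outcomes are random because the state just before
is invariant under conjugation by `Z_Δ`, which anticommutes with `X_Δ`
(`trace_mul_eq_zero_of_anticomm`). -/

theorem zmod_two_cases (b : ZMod 2) : b = 0 ∨ b = 1 := by
  revert b; decide

/-- The scalar `(-1) ^ b`. -/
noncomputable def chi (b : ZMod 2) : ℂ := (-1) ^ b.val

@[simp] theorem chi_zero : chi 0 = 1 := by simp [chi]

@[simp] theorem chi_one : chi 1 = -1 := by simp [chi, ZMod.val_one]

theorem chi_add (a b : ZMod 2) : chi (a + b) = chi a * chi b := by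
  rcases zmod_two_cases a with rfl | rfl <;> rcases zmod_two_cases b with rfl | rfl <;>
    simp [show (1 : ZMod 2) + 1 = 0 from rfl]

theorem chi_mul_self (a : ZMod 2) : chi a * chi a = 1 := by
  rcases zmod_two_cases a with rfl | rfl <;> simp

theorem chi_injective : Function.Injective chi := by
  intro a b h
  rcases zmod_two_cases a with rfl | rfl <;> rcases zmod_two_cases b with rfl | rfl
  · rfl
  · norm_num at h
  · norm_num at h
  · rfl

section

variable {ι κ : Type} [Fintype ι] [DecidableEq ι] [Fintype κ] [DecidableEq κ]

theorem coe_sgn (b : ZMod 2) : ((sgn b : Un ι) : Op ι) = chi b • (1 : Op ι) := by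
  rcases zmod_two_cases b with rfl | rfl
  · simp [sgn]
  · simp only [sgn, ZMod.val_one, pow_one, chi_one, neg_one_smul]; rfl

theorem coe_sgn_mul (b : ZMod 2) (P : Un ι) :
    ((sgn b * P : Un ι) : Op ι) = chi b • (P : Op ι) := by
  simp [coe_sgn]

theorem conjTranspose_mul_self (P : Un ι) : (P : Op ι)ᴴ * (P : Op ι) = 1 := by
  have := Matrix.mem_unitaryGroup_iff'.mp P.2
  rwa [Matrix.star_eq_conjTranspose] at this

theorem mul_conjTranspose_self (P : Un ι) : (P : Op ι) * (P : Op ι)ᴴ = 1 := by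
  have := Matrix.mem_unitaryGroup_iff.mp P.2
  rwa [Matrix.star_eq_conjTranspose] at this

theorem conjTranspose_eq_self {P : Un ι} (h : P * P = 1) : (P : Op ι)ᴴ = P := by
  have h' : (P : Op ι) * P = 1 := congrArg Subtype.val h
  rw [← one_mul (P : Op ι)ᴴ, ← h', mul_assoc, mul_conjTranspose_self, mul_one]

theorem coe_ne_zero (P : Un ι) : (P : Op ι) ≠ 0 := by
  intro h
  have := mul_conjTranspose_self P
  rw [h, zero_mul] at this
  exact zero_ne_one this

/-- `P` and `Q` commute up to the sign `(-1) ^ s`. -/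
def SignComm (s : ZMod 2) (P Q : Un ι) : Prop :=
  (P : Op ι) * (Q : Op ι) = chi s • ((Q : Op ι) * (P : Op ι))

theorem SignComm.symm {s : ZMod 2} {P Q : Un ι} (h : SignComm s P Q) : SignComm s Q P := by
  rw [SignComm] at *
  rw [h, smul_smul, chi_mul_self, one_smul]

theorem signComm_zero_iff {P Q : Un ι} : SignComm 0 P Q ↔ P * Q = Q * P := by
  rw [SignComm, chi_zero, one_smul, Subtype.ext_iff]; rfl

theorem signComm_one_iff {P Q : Un ι} : SignComm 1 P Q ↔ P * Q = -(Q * P) := by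
  rw [SignComm, chi_one, neg_one_smul, Subtype.ext_iff]; rfl

theorem SignComm.mul_right {s t : ZMod 2} {P Q R : Un ι} (h : SignComm s P Q)
    (h' : SignComm t P R) : SignComm (s + t) P (Q * R) := by
  rw [SignComm] at *
  rw [Submonoid.coe_mul, ← mul_assoc, h, smul_mul_assoc, mul_assoc, h', mul_smul_comm, smul_smul,
    chi_add, mul_assoc]

theorem signComm_one_right (P : Un ι) : SignComm 0 P 1 := by
  simp [signComm_zero_iff]

/-- Sign-commutation passes to scalar multiples. -/
theorem SignComm.of_smul {s : ZMod 2} {P P' Q Q' : Un ι} {a b : ℂ} (h : SignComm s P Q)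
    (hP : (P' : Op ι) = a • (P : Op ι)) (hQ : (Q' : Op ι) = b • (Q : Op ι)) :
    SignComm s P' Q' := by
  rw [SignComm] at *
  rw [hP, hQ, smul_mul_smul_comm, smul_mul_smul_comm, h, smul_smul, smul_smul, mul_comm b a,
    mul_comm]

/-- The product of two unitaries is nonzero, so the sign is determined. This lets exponents of a
word be read off from commutation signs. -/
theorem SignComm.eq {s t : ZMod 2} {P Q : Un ι} (h : SignComm s P Q) (h' : SignComm t P Q) :
    s = t := by
  rw [SignComm] at h h'
  rw [h] at h'
  have := smul_left_injective ℂ (coe_ne_zero (Q * P)) h'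
  exact chi_injective this

/-! ## The group of scalar multiples of Pauli strings -/

/-- The sum over the middle index in `ι → Fin 2` of a product over `ι` factors into a product of
sums over `Fin 2`. -/
theorem prod_entries_mul (A B : ι → Matrix (Fin 2) (Fin 2) ℂ) :
    ((Matrix.of fun a b => ∏ i, A i (a i) (b i) : Op ι) *
      (Matrix.of fun a b => ∏ i, B i (a i) (b i) : Op ι)) =
      Matrix.of fun a b => ∏ i, (A i * B i) (a i) (b i) := by
  ext a b
  simp only [Matrix.mul_apply, Matrix.of_apply, ← Finset.prod_mul_distrib]
  rw [Finset.prod_univ_sum, Fintype.piFinset_univ]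

theorem prod_entries_one :
    (Matrix.of fun a b => ∏ i, (1 : Matrix (Fin 2) (Fin 2) ℂ) (a i) (b i) : Op ι) = 1 := by
  ext a b
  simp only [Matrix.of_apply, Matrix.one_apply, funext_iff]
  rw [Finset.prod_ite_zero]
  simp

theorem pauliMatrix_zero : pauliMatrix 0 = 1 := by
  ext i j; fin_cases i <;> fin_cases j <;> simp [pauliMatrix]

theorem pauliMatrix_mul_self (p : Fin 4) : pauliMatrix p * pauliMatrix p = 1 := by
  fin_cases p <;> ext i j <;> fin_cases i <;> fin_cases j <;>
    simp [pauliMatrix, Matrix.mul_apply]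

theorem pauliMatrix_conjTranspose (p : Fin 4) : (pauliMatrix p)ᴴ = pauliMatrix p := by
  fin_cases p <;> ext i j <;> fin_cases i <;> fin_cases j <;> simp [pauliMatrix]

theorem pauliMatrix_star (p : Fin 4) : ∃ s : ℂ, (pauliMatrix p).map star = s • pauliMatrix p := by
  -- Only `Y` has non-real entries, and they are purely imaginary.
  refine ⟨if p = 2 then -1 else 1, ?_⟩
  fin_cases p <;> ext i j <;> fin_cases i <;> fin_cases j <;> simp [pauliMatrix]

theorem pauliMatrix_mul (p q : Fin 4) :
    ∃ (c : ℂ) (r : Fin 4), pauliMatrix p * pauliMatrix q = c • pauliMatrix r := by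
  refine ⟨(![![1, 1, 1, 1], ![1, 1, Complex.I, -Complex.I], ![1, -Complex.I, 1, Complex.I],
    ![1, Complex.I, -Complex.I, 1]] : Fin 4 → Fin 4 → ℂ) p q,
    (![![0, 1, 2, 3], ![1, 0, 3, 2], ![2, 3, 0, 1], ![3, 2, 1, 0]] : Fin 4 → Fin 4 → Fin 4) p q,
    ?_⟩
  fin_cases p <;> fin_cases q <;> ext i j <;> fin_cases i <;> fin_cases j <;>
    simp [pauliMatrix, Matrix.mul_apply]

theorem pauliMatrix_mul_comm (p q : Fin 4) :
    ∃ s : ZMod 2, pauliMatrix p * pauliMatrix q = chi s • (pauliMatrix q * pauliMatrix p) := by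
  -- Two distinct non-identity Pauli matrices anticommute.
  refine ⟨if p = 0 ∨ q = 0 ∨ p = q then 0 else 1, ?_⟩
  fin_cases p <;> fin_cases q <;> ext i j <;> fin_cases i <;> fin_cases j <;>
    simp [pauliMatrix, Matrix.mul_apply]

theorem pauliString_zero : pauliString (fun _ : ι => 0) = 1 := by
  simp only [pauliString, pauliMatrix_zero, prod_entries_one]

theorem pauliString_mul_self (p : ι → Fin 4) : pauliString p * pauliString p = 1 := by
  rw [pauliString, prod_entries_mul]
  simp only [pauliMatrix_mul_self, prod_entries_one]

theorem pauliString_mul (p q : ι → Fin 4) :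
    ∃ (c : ℂ) (r : ι → Fin 4), pauliString p * pauliString q = c • pauliString r := by
  choose c r h using fun i => pauliMatrix_mul (p i) (q i)
  refine ⟨∏ i, c i, r, ?_⟩
  rw [pauliString, pauliString, prod_entries_mul]
  ext a b
  simp [h, pauliString, Finset.prod_mul_distrib]

theorem prod_chi (s : ι → ZMod 2) : ∏ i, chi (s i) = chi (∑ i, s i) := by
  classical
  induction (Finset.univ : Finset ι) using Finset.induction_on with
  | empty => simp
  | insert i t hi ih => rw [Finset.prod_insert hi, Finset.sum_insert hi, ih, chi_add]

theorem pauliString_mul_comm (p q : ι → Fin 4) :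
    ∃ s : ZMod 2, pauliString p * pauliString q = chi s • (pauliString q * pauliString p) := by
  choose s h using fun i => pauliMatrix_mul_comm (p i) (q i)
  refine ⟨∑ i, s i, ?_⟩
  rw [pauliString, pauliString, prod_entries_mul, prod_entries_mul]
  ext a b
  simp [h, Finset.prod_mul_distrib, prod_chi]

theorem pauliString_conjTranspose (p : ι → Fin 4) : (pauliString p)ᴴ = pauliString p := by
  ext a b
  have h : ∀ i, star (pauliMatrix (p i) (b i) (a i)) = pauliMatrix (p i) (a i) (b i) := fun i => by
    conv_rhs => rw [← pauliMatrix_conjTranspose (p i)]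
    rfl
  simp only [pauliString, Matrix.conjTranspose_apply, Matrix.of_apply, star_prod, h]

theorem pauliString_star (p : ι → Fin 4) :
    ∃ s : ℂ, (pauliString p).map star = s • pauliString p := by
  choose s h using fun i => pauliMatrix_star (p i)
  refine ⟨∏ i, s i, ?_⟩
  ext a b
  have h' : ∀ i, star (pauliMatrix (p i) (a i) (b i)) = s i * pauliMatrix (p i) (a i) (b i) :=
    fun i => congrFun (congrFun (h i) (a i)) (b i)
  simp only [pauliString, Matrix.map_apply, Matrix.of_apply, star_prod, h', Matrix.smul_apply,
    smul_eq_mul, Finset.prod_mul_distrib]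

theorem pauliString_sumElim (p : ι → Fin 4) (q : κ → Fin 4) :
    pauliString (Sum.elim p q) = tensorOp (pauliString p) (pauliString q) := by
  ext a b
  simp [pauliString, tensorOp, Fintype.prod_sum_type]

/-- The unitaries that are scalar multiples of Pauli strings. -/
def scaledPauliGroup (ι : Type) [Fintype ι] [DecidableEq ι] : Subgroup (Un ι) where
  carrier := {P | ∃ (c : ℂ) (p : ι → Fin 4), (P : Op ι) = c • pauliString p}
  one_mem' := ⟨1, fun _ => 0, by rw [pauliString_zero, one_smul]; rfl⟩
  mul_mem' := by
    rintro P Q ⟨c, p, hP⟩ ⟨d, q, hQ⟩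
    obtain ⟨e, r, h⟩ := pauliString_mul p q
    exact ⟨c * d * e, r, by rw [Submonoid.coe_mul, hP, hQ, smul_mul_smul_comm, h, smul_smul]⟩
  inv_mem' := by
    rintro P ⟨c, p, hP⟩
    refine ⟨star c, p, ?_⟩
    rw [show ((P⁻¹ : Un ι) : Op ι) = (P : Op ι)ᴴ from rfl, hP, Matrix.conjTranspose_smul,
      pauliString_conjTranspose]

theorem IsPauli.mem_scaledPauliGroup {P : Un ι} (h : IsPauli P) : P ∈ scaledPauliGroup ι := by
  obtain ⟨k, p, h⟩ := h
  exact ⟨_, p, h⟩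

theorem IsPauliObservable.mem_scaledPauliGroup {P : Un ι} (h : IsPauliObservable P) :
    P ∈ scaledPauliGroup ι := by
  obtain ⟨p, h | h⟩ := h
  · exact ⟨1, p, by rw [h, one_smul]⟩
  · exact ⟨-1, p, by rw [h, neg_one_smul]⟩

theorem IsPauliObservable.mul_self {P : Un ι} (h : IsPauliObservable P) : P * P = 1 := by
  apply Subtype.ext
  obtain ⟨p, h | h⟩ := h <;> rw [Submonoid.coe_mul, h]
  · exact pauliString_mul_self p
  · rw [neg_mul_neg]; exact pauliString_mul_self p

theorem exists_signComm {P Q : Un ι} (hP : P ∈ scaledPauliGroup ι) (hQ : Q ∈ scaledPauliGroup ι) :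
    ∃ s, SignComm s P Q := by
  obtain ⟨c, p, hP⟩ := hP
  obtain ⟨d, q, hQ⟩ := hQ
  obtain ⟨s, h⟩ := pauliString_mul_comm p q
  refine ⟨s, ?_⟩
  rw [SignComm, hP, hQ, smul_mul_smul_comm, smul_mul_smul_comm, h, smul_comm, mul_comm c d]

theorem conj_mem_scaledPauliGroup {P : Un ι} (hP : P ∈ scaledPauliGroup ι) :
    conj P ∈ scaledPauliGroup ι := by
  obtain ⟨c, p, hP⟩ := hP
  obtain ⟨s, h⟩ := pauliString_star p
  refine ⟨star c * s, p, ?_⟩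
  rw [← smul_smul, ← h]
  ext a b
  simp [conj, hP]

theorem tensorOp_smul (a b : ℂ) (A : Op ι) (B : Op κ) :
    tensorOp (a • A) (b • B) = (a * b) • tensorOp A B := by
  simp [tensorOp, Matrix.smul_kronecker, Matrix.kronecker_smul, smul_smul, mul_comm,
    Matrix.submatrix_smul]

theorem tensorOp_mul (A C : Op ι) (B D : Op κ) :
    tensorOp A B * tensorOp C D = tensorOp (A * C) (B * D) := by
  rw [tensorOp, tensorOp, tensorOp, Matrix.submatrix_mul_equiv, ← Matrix.mul_kronecker_mul]

theorem tensor_mem_scaledPauliGroup {P : Un ι} {Q : Un κ} (hP : P ∈ scaledPauliGroup ι)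
    (hQ : Q ∈ scaledPauliGroup κ) : tensor P Q ∈ scaledPauliGroup (ι ⊕ κ) := by
  obtain ⟨c, p, hP⟩ := hP
  obtain ⟨d, q, hQ⟩ := hQ
  exact ⟨c * d, Sum.elim p q, by
    rw [pauliString_sumElim, ← tensorOp_smul, ← hP, ← hQ]; rfl⟩

/-- Entrywise conjugation is multiplicative and the sign is real. -/
theorem SignComm.conj {s : ZMod 2} {P Q : Un ι} (h : SignComm s P Q) :
    SignComm s (conj P) (conj Q) := by
  have key : ∀ A B : Un ι, ((StabChoi.conj A : Un ι) : Op ι) * ((StabChoi.conj B : Un ι) : Op ι) =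
      ((A : Op ι) * (B : Op ι)).map star := fun A B => by
    ext a b
    simp [StabChoi.conj, Matrix.mul_apply]
  have hs : star (chi s) = chi s := by rcases zmod_two_cases s with rfl | rfl <;> simp
  rw [SignComm] at *
  rw [key, key, h]
  ext a b
  rw [Matrix.map_apply, Matrix.smul_apply, Matrix.smul_apply, Matrix.map_apply, smul_eq_mul,
    smul_eq_mul, star_mul', hs]

theorem SignComm.tensor {s t : ZMod 2} {P Q : Un ι} {P' Q' : Un κ} (h : SignComm s P Q)
    (h' : SignComm t P' Q') : SignComm (s + t) (tensor P P') (tensor Q Q') := by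
  rw [SignComm] at *
  simp only [StabChoi.tensor, tensorOp_mul, h, h', tensorOp_smul, chi_add]

/-! ## A maximal family of commuting Pauli unitaries generates its commutant up to scalars -/

section Words

variable {K : Type} [Fintype K]

/-- The product of the operators `w k` over those `k` with `a k = 1`. -/
noncomputable def word (w : K → Un ι) (a : K → ZMod 2) : Un ι :=
  ((Finset.univ : Finset K).toList.map fun k => if a k = 1 then w k else 1).prod

theorem word_mem {w : K → Un ι} {H : Subgroup (Un ι)} (h : ∀ k, w k ∈ H) (a : K → ZMod 2) :
    word w a ∈ H := by
  refine Subgroup.list_prod_mem _ fun P hP => ?_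
  obtain ⟨k, -, rfl⟩ := List.mem_map.mp hP
  split_ifs
  exacts [h k, one_mem _]

theorem word_zero (w : K → Un ι) : word w 0 = 1 := by
  simp [word]

theorem signComm_word {R : Un ι} {w : K → Un ι} {t : K → ZMod 2}
    (h : ∀ k, SignComm (t k) R (w k)) (a : K → ZMod 2) :
    SignComm (∑ k, a k * t k) R (word w a) := by
  rw [word, ← Finset.sum_map_toList]
  induction (Finset.univ : Finset K).toList with
  | nil => simpa using signComm_one_right R
  | cons k l ih =>
    simp only [List.map_cons, List.sum_cons, List.prod_cons]
    refine SignComm.mul_right ?_ ih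
    rcases zmod_two_cases (a k) with hk | hk
    · simpa [hk] using signComm_one_right R
    · simpa [hk] using h k

variable [DecidableEq K]

/-- The signs against `g` and `h` recover all exponents of a word, so the `2^N · 2^N` words
represent distinct Pauli strings. There are `4^N` strings, hence every one occurs. Commuting with
all `g` forces the exponents of `h` to vanish. -/
theorem exists_smul_eq_of_commute {g h : K → Un ι} (card : Fintype.card K = Fintype.card ι)
    (hg : ∀ k, g k ∈ scaledPauliGroup ι) (hh : ∀ k, h k ∈ scaledPauliGroup ι)
    (hgg : ∀ k l, SignComm 0 (g k) (g l))
    (hgh : ∀ k l, SignComm (if k = l then 1 else 0) (g k) (h l))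
    {T : Un ι} (hT : T ∈ scaledPauliGroup ι) (hTg : ∀ k, SignComm 0 T (g k)) :
    ∃ (c : ℂ), ∃ E ∈ Subgroup.closure (Set.range g), (T : Op ι) = c • (E : Op ι) := by
  have hE : ∀ ab : (K → ZMod 2) × (K → ZMod 2), word g ab.1 * word h ab.2 ∈ scaledPauliGroup ι :=
    fun ab => mul_mem (word_mem hg _) (word_mem hh _)
  choose c p hp using hE
  -- The `h k` are not assumed to commute with one another; `τ` records their mutual signs.
  choose τ hτ using fun k l => exists_signComm (hh k) (hh l)
  have sg : ∀ (l : K) (ab : (K → ZMod 2) × (K → ZMod 2)),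
      SignComm (ab.2 l) (g l) (word g ab.1 * word h ab.2) := fun l ab => by
    have := (signComm_word (hgg l) ab.1).mul_right (signComm_word (hgh l) ab.2)
    simpa using this
  have sh : ∀ (l : K) (ab : (K → ZMod 2) × (K → ZMod 2)),
      SignComm (ab.1 l + ∑ k, ab.2 k * τ l k) (h l) (word g ab.1 * word h ab.2) := fun l ab => by
    have := (signComm_word (fun k => (hgh k l).symm) ab.1).mul_right (signComm_word (hτ l) ab.2)
    simpa using this
  have scal : ∀ {U V : Un ι} {a b : ℂ} {q : ι → Fin 4}, (U : Op ι) = a • pauliString q →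
      (V : Op ι) = b • pauliString q → (U : Op ι) = (a / b) • (V : Op ι) := by
    intro U V a b q hU hV
    have hb : b ≠ 0 := by
      rintro rfl
      exact coe_ne_zero V (by rw [hV, zero_smul])
    rw [hU, hV, smul_smul, div_mul_cancel₀ _ hb]
  have inj : Function.Injective p := by
    intro ab ab' hpp
    have hs := scal (hp ab) (hpp ▸ hp ab')
    have h2 : ab.2 = ab'.2 := funext fun l =>
      (sg l ab).eq ((sg l ab').of_smul (one_smul ℂ _).symm hs)
    -- Once the exponents of `h` agree, the contributions of `τ` agree too and cancel.
    have h1 : ab.1 = ab'.1 := funext fun l => by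
      have := (sh l ab).eq ((sh l ab').of_smul (one_smul ℂ _).symm hs)
      rw [h2] at this
      exact add_right_cancel this
    exact Prod.ext h1 h2
  have bij : Function.Bijective p := by
    refine (Fintype.bijective_iff_injective_and_card p).mpr ⟨inj, ?_⟩
    simp [ZMod.card, card, ← mul_pow]
  obtain ⟨d, q, hq⟩ := hT
  obtain ⟨ab, rfl⟩ := bij.2 q
  have hs := scal hq (hp ab)
  have h0 : ab.2 = 0 := funext fun l =>
    ((sg l ab).of_smul (one_smul ℂ _).symm hs).eq (hTg l).symm
  rw [h0, word_zero, mul_one] at hs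
  exact ⟨d / c ab, word g ab.1,
    word_mem (fun k => Subgroup.subset_closure (Set.mem_range_self k)) _, hs⟩

end Words

/-! ## Stabilizers of a nonzero vector -/

theorem stabilizers_smul (c : ℂ) (hc : c ≠ 0) (ψ : (ι → Fin 2) → ℂ) :
    stabilizers (c • ψ) = stabilizers ψ := by
  ext P
  simp only [stabilizers, Set.mem_ofPred_eq, Matrix.mulVec_smul, smul_right_inj hc]

/-- For `P = c • pauliString p`, the square is the scalar `c²`, which fixes a nonzero vector; so `c
= ±1`. -/
theorem isPauliObservable_of_mulVec_eq {P : Un ι} (hP : P ∈ scaledPauliGroup ι)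
    {ψ : (ι → Fin 2) → ℂ} (hψ : ψ ≠ 0) (h : (P : Op ι) *ᵥ ψ = ψ) : IsPauliObservable P := by
  obtain ⟨c, p, hP⟩ := hP
  have h2 : (c * c) • ψ = (1 : ℂ) • ψ := by
    have : ((P : Op ι) * (P : Op ι)) *ᵥ ψ = ψ := by rw [← Matrix.mulVec_mulVec, h, h]
    rw [hP, smul_mul_smul_comm, pauliString_mul_self, Matrix.smul_mulVec, Matrix.one_mulVec] at this
    rw [this, one_smul]
  rcases mul_self_eq_one_iff.mp (smul_left_injective ℂ hψ h2) with rfl | rfl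
  · exact ⟨p, Or.inl (by rw [hP, one_smul])⟩
  · exact ⟨p, Or.inr (by rw [hP, neg_one_smul])⟩

/-- `N` independent commuting Pauli unitaries that fix a nonzero vector of `N` qubits generate
its group of stabilizers. -/
theorem closure_eq_stabilizers {K : Type} [Fintype K] [DecidableEq K] {g h : K → Un ι}
    (card : Fintype.card K = Fintype.card ι)
    (hg : ∀ k, g k ∈ scaledPauliGroup ι) (hh : ∀ k, h k ∈ scaledPauliGroup ι)
    (hgg : ∀ k l, SignComm 0 (g k) (g l))
    (hgh : ∀ k l, SignComm (if k = l then 1 else 0) (g k) (h l))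
    {ψ : (ι → Fin 2) → ℂ} (hψ : ψ ≠ 0) (hfix : ∀ k, (g k : Op ι) *ᵥ ψ = ψ) :
    (Subgroup.closure (Set.range g) : Set (Un ι)) = stabilizers ψ := by
  have fix : ∀ E ∈ Subgroup.closure (Set.range g), (E : Op ι) *ᵥ ψ = ψ := by
    intro E hE
    induction hE using Subgroup.closure_induction with
    | mem x hx => obtain ⟨k, rfl⟩ := hx; exact hfix k
    | one => simp
    | mul x y _ _ hx hy => rw [Submonoid.coe_mul, ← Matrix.mulVec_mulVec, hy, hx]
    | inv x _ hx =>
      nth_rewrite 1 [← hx]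
      rw [Matrix.mulVec_mulVec, show ((x⁻¹ : Un ι) : Op ι) = (x : Op ι)ᴴ from rfl,
        conjTranspose_mul_self, Matrix.one_mulVec]
  have pauli : Subgroup.closure (Set.range g) ≤ scaledPauliGroup ι := by
    rw [Subgroup.closure_le]
    rintro _ ⟨k, rfl⟩
    exact hg k
  ext T
  constructor
  · intro hT
    exact ⟨isPauliObservable_of_mulVec_eq (pauli hT) hψ (fix T hT), fix T hT⟩
  · rintro ⟨hobs, hT⟩
    -- Both operators fix `ψ ≠ 0`, so comparing the two orders of application on `ψ` excludes the
    -- sign `-1`.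
    have hTg : ∀ k, SignComm 0 T (g k) := by
      intro k
      obtain ⟨s, hs⟩ := exists_signComm hobs.mem_scaledPauliGroup (hg k)
      have h1 : chi s • ψ = (1 : ℂ) • ψ := by
        have e := congrArg (fun A : Op ι => A *ᵥ ψ) hs
        simp only [Matrix.smul_mulVec, ← Matrix.mulVec_mulVec, hT, hfix] at e
        rw [← e, one_smul]
      have h2 : chi s = chi 0 := by
        rw [chi_zero]; exact smul_left_injective ℂ hψ h1
      rwa [chi_injective h2] at hs
    obtain ⟨c, E, hE, h⟩ :=
      exists_smul_eq_of_commute card hg hh hgg hgh hobs.mem_scaledPauliGroup hTg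
    have hc : c • ψ = (1 : ℂ) • ψ := by
      rw [h, Matrix.smul_mulVec, fix E hE] at hT
      rw [hT, one_smul]
    rw [smul_left_injective ℂ hψ hc, one_smul] at h
    rw [SetLike.mem_coe, Subtype.ext h]
    exact hE

end

section

variable {ι L J : Type} [Fintype ι] [DecidableEq ι]

/-! ## Linear maps enacted by circuits -/

theorem kraus_measure (v : L → ZMod 2) (l : L) (P : Un ι) :
    (StabOp.measure l P).kraus v = (1 / 2 : ℂ) • (1 + chi (v l) • (P : Op ι)) := by
  rw [StabOp.kraus, coe_sgn_mul]

theorem kraus_condPauli_singleton (v : L → ZMod 2) (l : L) (P : Un ι) :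
    (StabOp.condPauli {l} P).kraus v = if v l = 1 then (P : Op ι) else 1 := by
  simp [StabOp.kraus]

theorem kraus_append (v : L → ZMod 2) (C₁ C₂ : Circuit ι L) :
    Circuit.kraus v (C₁ ++ C₂) = Circuit.kraus v C₂ * Circuit.kraus v C₁ := by
  induction C₁ with
  | nil => simp [Circuit.kraus]
  | cons g C ih => rw [List.cons_append, Circuit.kraus, Circuit.kraus, ih, mul_assoc]

theorem kraus_relabel {L' : Type} (f : L ↪ L') (v : L' → ZMod 2) (C : Circuit ι L) :
    Circuit.kraus v (C.map (StabOp.relabel f)) = Circuit.kraus (v ∘ f) C := by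
  induction C with
  | nil => rfl
  | cons g C ih =>
    rw [List.map_cons, Circuit.kraus, Circuit.kraus, ih]
    congr 1
    cases g with
    | measure l P => rfl
    | condPauli c P => simp [StabOp.relabel, StabOp.kraus]

theorem kraus_seq {L' : Type} (v : L → ZMod 2) (v' : L' → ZMod 2) (C : Circuit ι L)
    (C' : Circuit ι L') :
    Circuit.kraus (Sum.elim v v') (C.seq C') = Circuit.kraus v' C' * Circuit.kraus v C := by
  rw [Circuit.seq, kraus_append, kraus_relabel, kraus_relabel]
  rfl

/-- Intertwining is checked one operation at a time. With `v = v'` this gives commutation; with `v ≠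
v'` it expresses that `A` flips outcomes; with `A = 1` it compares two outcome vectors. -/
theorem mul_kraus_of_forall {A : Op ι} {v v' : L → ZMod 2} {C : Circuit ι L}
    (h : ∀ g ∈ C, A * g.kraus v = g.kraus v' * A) :
    A * Circuit.kraus v C = Circuit.kraus v' C * A := by
  induction C with
  | nil => simp [Circuit.kraus]
  | cons g C ih =>
    rw [Circuit.kraus, Circuit.kraus, ← mul_assoc, ih fun g hg => h g (List.mem_cons_of_mem _ hg),
      mul_assoc, h g List.mem_cons_self, mul_assoc]

/-- Measurement of `P j`, with outcome named `f j`, for the `j` in a list. -/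
def measureAll (f : J → L) (P : J → Un ι) (js : List J) : Circuit ι L :=
  js.map fun j => .measure (f j) (P j)

/-- Application of `P j` if the outcome named `f j` is one, for the `j` in a list. -/
def condAll (f : J → L) (P : J → Un ι) (js : List J) : Circuit ι L :=
  js.map fun j => .condPauli {f j} (P j)

theorem commute_kraus_measureAll {R : Un ι} {f : J → L} {P : J → Un ι} {js : List J}
    (v : L → ZMod 2) (h : ∀ j ∈ js, R * P j = P j * R) :
    Commute (R : Op ι) (Circuit.kraus v (measureAll f P js)) := by
  refine mul_kraus_of_forall fun g hg => ?_
  obtain ⟨j, hj, rfl⟩ := List.mem_map.mp hg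
  have : (R : Op ι) * P j = P j * R := congrArg Subtype.val (h j hj)
  simp [kraus_measure, mul_add, add_mul, this]

/-- `P j` commutes past the later measurements to its own projector, where `P (1 + χ P) = χ (1 + χ
P)` because `P² = 1` and `χ² = 1`. -/
theorem mul_kraus_measureAll {f : J → L} {P : J → Un ι} (v : L → ZMod 2)
    (hP : ∀ i j, P i * P j = P j * P i) {j : J} (hj : P j * P j = 1) {js : List J}
    (hjs : j ∈ js) :
    (P j : Op ι) * Circuit.kraus v (measureAll f P js) =
      chi (v (f j)) • Circuit.kraus v (measureAll f P js) := by
  obtain ⟨as, bs, rfl⟩ := List.append_of_mem hjs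
  have h1 := commute_kraus_measureAll (f := f) v fun i (_ : i ∈ bs) => hP j i
  have h2 : (P j : Op ι) * P j = 1 := congrArg Subtype.val hj
  have h3 : (P j : Op ι) * (StabOp.measure (f j) (P j)).kraus v =
      chi (v (f j)) • (StabOp.measure (f j) (P j)).kraus v := by
    have h4 : (P j : Op ι) * (1 + chi (v (f j)) • (P j : Op ι)) =
        chi (v (f j)) • (1 + chi (v (f j)) • (P j : Op ι)) := by
      rw [mul_add, mul_one, mul_smul_comm, h2, smul_add, smul_smul, chi_mul_self, one_smul,
        add_comm]
    rw [kraus_measure, mul_smul_comm, h4, smul_comm]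
  rw [measureAll] at *
  rw [List.map_append, List.map_cons, kraus_append, Circuit.kraus, ← mul_assoc, ← mul_assoc,
    h1.eq, mul_assoc _ (P j : Op ι), h3, mul_smul_comm, smul_mul_assoc]

theorem kraus_measureAll_mul {f : J → L} {P : J → Un ι} (v : L → ZMod 2)
    (hP : ∀ i j, P i * P j = P j * P i) {j : J} (hj : P j * P j = 1) {js : List J}
    (hjs : j ∈ js) :
    Circuit.kraus v (measureAll f P js) * (P j : Op ι) =
      chi (v (f j)) • Circuit.kraus v (measureAll f P js) := by
  rw [← (commute_kraus_measureAll v fun i _ => hP j i).eq, mul_kraus_measureAll v hP hj hjs]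

theorem commute_kraus_condAll {R : Un ι} {f : J → L} {P : J → Un ι} {js : List J}
    (v : L → ZMod 2) (h : ∀ j ∈ js, R * P j = P j * R) :
    Commute (R : Op ι) (Circuit.kraus v (condAll f P js)) := by
  refine mul_kraus_of_forall fun g hg => ?_
  obtain ⟨j, hj, rfl⟩ := List.mem_map.mp hg
  have : (R : Op ι) * P j = P j * R := congrArg Subtype.val (h j hj)
  rw [kraus_condPauli_singleton]
  split_ifs
  exacts [this, by simp]

/-- An operator that anticommutes with one of the conditional Pauli unitaries picks up the sign
given by the corresponding outcome. -/
theorem mul_kraus_condAll {R : Un ι} {f : J → L} {P : J → Un ι} (v : L → ZMod 2)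
    {js : List J} (hjs : js.Nodup) {j : J} (hj : j ∈ js) (h : R * P j = -(P j * R))
    (h' : ∀ i, i ≠ j → R * P i = P i * R) :
    (R : Op ι) * Circuit.kraus v (condAll f P js) =
      chi (v (f j)) • (Circuit.kraus v (condAll f P js) * R) := by
  obtain ⟨as, bs, rfl⟩ := List.append_of_mem hj
  -- As `j` occurs only once in the list, exactly one factor contributes a sign.
  have hjas : j ∉ as := fun hm => List.nodup_append.mp hjs |>.2.2 j hm j List.mem_cons_self rfl
  have hjbs : j ∉ bs := (List.nodup_cons.mp (List.nodup_append.mp hjs).2.1).1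
  have h1 := commute_kraus_condAll (f := f) v fun i (hi : i ∈ as) =>
    h' i fun e => hjas (e ▸ hi)
  have h2 := commute_kraus_condAll (f := f) v fun i (hi : i ∈ bs) =>
    h' i fun e => hjbs (e ▸ hi)
  have h3 : (R : Op ι) * (StabOp.condPauli {f j} (P j)).kraus v =
      chi (v (f j)) • ((StabOp.condPauli {f j} (P j)).kraus v * R) := by
    have : (R : Op ι) * P j = -(P j * R) := congrArg Subtype.val h
    rw [kraus_condPauli_singleton]
    rcases zmod_two_cases (v (f j)) with hv | hv <;> simp [hv, this]
  rw [show condAll f P (as ++ j :: bs) =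
    condAll f P as ++ StabOp.condPauli {f j} (P j) :: condAll f P bs from List.map_append,
    kraus_append, Circuit.kraus]
  calc (R : Op ι) * (Circuit.kraus v (condAll f P bs) * (StabOp.condPauli {f j} (P j)).kraus v *
        Circuit.kraus v (condAll f P as))
      = Circuit.kraus v (condAll f P bs) * (R * (StabOp.condPauli {f j} (P j)).kraus v) *
          Circuit.kraus v (condAll f P as) := by
        rw [← mul_assoc, ← mul_assoc, h2.eq, mul_assoc (Circuit.kraus v (condAll f P bs))]
    _ = chi (v (f j)) • (Circuit.kraus v (condAll f P bs) *
          (StabOp.condPauli {f j} (P j)).kraus v * (R * Circuit.kraus v (condAll f P as))) := by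
        rw [h3, mul_smul_comm, smul_mul_assoc]
        simp only [mul_assoc]
    _ = _ := by
        rw [h1.eq, ← mul_assoc]

theorem commute_condAll_measureAll {J' : Type} {f : J → L} {f' : J' → L} {P : J → Un ι}
    {P' : J' → Un ι} {js : List J} {js' : List J'} (v : L → ZMod 2)
    (h : ∀ i j, P i * P' j = P' j * P i) :
    Commute (Circuit.kraus v (condAll f P js)) (Circuit.kraus v (measureAll f' P' js')) := by
  refine mul_kraus_of_forall fun g hg => ?_
  obtain ⟨j, hj, rfl⟩ := List.mem_map.mp hg
  have := (commute_kraus_condAll (f := f) (js := js) v fun i _ => (h i j).symm).eq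
  simp [kraus_measure, mul_add, add_mul, this]

/-- Conditional Pauli unitaries absorbed by an operator that is an eigenvector of each of them. -/
theorem kraus_condAll_mul {f : J → L} {P : J → Un ι} {js : List J} (v : L → ZMod 2) {A : Op ι}
    {s : J → ZMod 2} (h : ∀ j, (P j : Op ι) * A = chi (s j) • A) :
    ∃ c, Circuit.kraus v (condAll f P js) * A = chi c • A := by
  induction js with
  | nil => exact ⟨0, by simp [condAll, Circuit.kraus]⟩
  | cons j js ih =>
    obtain ⟨c, hc⟩ := ih
    rw [condAll] at *
    rw [List.map_cons, Circuit.kraus, kraus_condPauli_singleton]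
    split_ifs
    · exact ⟨s j + c, by rw [mul_assoc, h, mul_smul_comm, hc, smul_smul, chi_add]⟩
    · exact ⟨c, by rw [mul_one, hc]⟩

/-- Measuring observables and then undoing the effect of the outcomes. -/
theorem kraus_condAll_mul_measureAll {f : J → L} {P R : J → Un ι} (v v' : L → ZMod 2)
    {js : List J} (hjs : js.Nodup) (hv' : ∀ j, v' (f j) = 0)
    (h : ∀ j, R j * P j = -(P j * R j)) (h' : ∀ i j, i ≠ j → R j * P i = P i * R j) :
    Circuit.kraus v (condAll f P js) * Circuit.kraus v (measureAll f R js) =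
      Circuit.kraus v' (measureAll f R js) * Circuit.kraus v (condAll f P js) := by
  refine mul_kraus_of_forall fun g hg => ?_
  obtain ⟨j, hj, rfl⟩ := List.mem_map.mp hg
  -- `R j` crosses the corrections with the sign `chi (v (f j))`, which is the sign in its
  -- projector; what remains is the projector for outcome zero.
  have := mul_kraus_condAll (f := f) v hjs hj (h j) fun i hi => h' i j hi
  rw [kraus_measure, kraus_measure, hv', chi_zero, one_smul, mul_smul_comm, smul_mul_assoc,
    mul_add, add_mul, this, mul_smul_comm, mul_one, one_mul]

theorem kraus_measureAll_congr {f : J → L} {P : J → Un ι} {js : List J} {v v' : L → ZMod 2}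
    (h : ∀ j, v (f j) = v' (f j)) :
    Circuit.kraus v (measureAll f P js) = Circuit.kraus v' (measureAll f P js) := by
  have := mul_kraus_of_forall (A := (1 : Op ι)) (v := v) (v' := v') (C := measureAll f P js)
    fun g hg => by
      obtain ⟨j, hj, rfl⟩ := List.mem_map.mp hg
      rw [kraus_measure, kraus_measure, h, one_mul, mul_one]
  simpa using this

theorem kraus_condAll_congr {f : J → L} {P : J → Un ι} {js : List J} {v v' : L → ZMod 2}
    (h : ∀ j, v (f j) = v' (f j)) :
    Circuit.kraus v (condAll f P js) = Circuit.kraus v' (condAll f P js) := by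
  have := mul_kraus_of_forall (A := (1 : Op ι)) (v := v) (v' := v') (C := condAll f P js)
    fun g hg => by
      obtain ⟨j, hj, rfl⟩ := List.mem_map.mp hg
      rw [kraus_condPauli_singleton, kraus_condPauli_singleton, h, one_mul, mul_one]
  simpa using this

/-! ## The Bell state -/

/-- The Bell state is the normalized vectorization of the identity: only the diagonal terms of the
sum survive, and they form the matrix product `A * Bᵀ`. -/
theorem tensorOp_mulVec_bell (A B : Op ι) (a : ι ⊕ ι → Fin 2) :
    (tensorOp A B *ᵥ bell ι) a = (A * Bᵀ) (fun i => a (Sum.inl i)) (fun i => a (Sum.inr i)) *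
      (1 / ((Real.sqrt 2 : ℝ) : ℂ) ^ Fintype.card ι) := by
  rw [Matrix.mulVec, dotProduct,
    ← (Equiv.sumArrowEquivProdArrow ι ι (Fin 2)).symm.sum_comp, Fintype.sum_prod_type,
    Matrix.mul_apply, Finset.sum_mul]
  refine Finset.sum_congr rfl fun k _ => ?_
  rw [Finset.sum_eq_single k]
  · simp [tensorOp, bell, Equiv.sumArrowEquivProdArrow]
    rfl
  · intro k' _ hk
    have : ¬ (fun i => k i) = fun i => k' i := fun e => hk e.symm
    simp [bell, Equiv.sumArrowEquivProdArrow, this]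
  · simp

theorem tensorOp_mulVec_bell_eq (A B : Op ι) :
    tensorOp A B *ᵥ bell ι = tensorOp (A * Bᵀ) 1 *ᵥ bell ι := by
  ext a
  simp [tensorOp_mulVec_bell]

theorem tensorOp_smul_left (c : ℂ) (A : Op ι) :
    tensorOp (c • A) (1 : Op ι) = c • tensorOp A 1 := by
  have := tensorOp_smul c 1 A (1 : Op ι)
  rwa [one_smul, mul_one] at this

theorem tensorOp_one_mulVec_bell_ne_zero {Q : Op ι} (hQ : Q ≠ 0) :
    tensorOp Q (1 : Op ι) *ᵥ bell ι ≠ 0 := by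
  intro h
  apply hQ
  ext a b
  have := congrFun h (Sum.elim a b)
  rw [tensorOp_mulVec_bell] at this
  simpa using this

/-- An operator on the second half of the Bell state moves to the first half as its transpose, and
the transpose of the entrywise conjugate is the adjoint. -/
theorem tensor_conj_mulVec (A B : Un ι) (Q : Op ι) :
    (tensor A (conj B) : Op (ι ⊕ ι)) *ᵥ (tensorOp Q (1 : Op ι) *ᵥ bell ι) =
      tensorOp ((A : Op ι) * Q * (B : Op ι)ᴴ) 1 *ᵥ bell ι := by
  rw [Matrix.mulVec_mulVec, show (tensor A (conj B) : Op (ι ⊕ ι)) =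
    tensorOp (A : Op ι) ((B : Op ι).map star) from rfl, tensorOp_mul, tensorOp_mulVec_bell_eq,
    mul_one]
  rfl

/-! ## Randomness -/

/-- The sign `chi s` enters `K ρ K†` twice, so this operator is invariant under conjugation by `Z`.
Moving `Z` cyclically around the trace past `P` shows that the trace equals its own negative. -/
theorem trace_mul_eq_zero_of_anticomm {P Z : Un ι} {K : Op ι} (h : P * Z = -(Z * P))
    {s : ZMod 2} (hK : (Z : Op ι) * K = chi s • K) (ρ : Op ι) :
    Matrix.trace ((P : Op ι) * (K * ρ * Kᴴ)) = 0 := by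
  have h1 : (Z : Op ι) * (K * ρ * Kᴴ) * (Z : Op ι)ᴴ = K * ρ * Kᴴ := by
    have h2 : Kᴴ * (Z : Op ι)ᴴ = chi s • Kᴴ := by
      rw [← Matrix.conjTranspose_mul, hK, Matrix.conjTranspose_smul]
      rcases zmod_two_cases s with rfl | rfl <;> simp
    rw [← mul_assoc, ← mul_assoc, hK, mul_assoc, h2, mul_smul_comm, smul_mul_assoc, smul_mul_assoc,
      smul_smul, chi_mul_self, one_smul]
  have h2 : (P : Op ι) * Z = -(Z * P) := congrArg Subtype.val h
  have h3 : Matrix.trace ((P : Op ι) * (K * ρ * Kᴴ)) =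
      -Matrix.trace ((P : Op ι) * (K * ρ * Kᴴ)) := by
    conv_lhs => rw [← h1]
    rw [← mul_assoc, ← mul_assoc, h2, Matrix.trace_mul_comm, ← mul_assoc, mul_neg,
      ← mul_assoc (Z : Op ι)ᴴ, conjTranspose_mul_self, one_mul, neg_mul, Matrix.trace_neg]
  exact self_eq_neg.mp h3

/-- With `E` the projector and `σ` the unnormalized state before the measurement, `tr (E σ E) = tr
(E σ) = (tr σ ± tr (P σ)) / 2`, and the last trace vanishes. -/
theorem prob_append_measure {C : Circuit ι L} {v : L → ZMod 2} {l : L} {P Z : Un ι}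
    (hP : P * P = 1) (h : P * Z = -(Z * P)) {s : ZMod 2}
    (hK : (Z : Op ι) * Circuit.kraus v C = chi s • Circuit.kraus v C) (ρ : Op ι) :
    Circuit.prob (C ++ [StabOp.measure l P]) v ρ = Circuit.prob C v ρ / 2 := by
  have hPP : (P : Op ι) * P = 1 := congrArg Subtype.val hP
  have hPH := conjTranspose_eq_self hP
  have hχ : star (chi (v l)) = chi (v l) := by
    rcases zmod_two_cases (v l) with h | h <;> simp [h]
  set E := (StabOp.measure l P).kraus v with hE
  have hEH : Eᴴ = E := by
    rw [hE, kraus_measure]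
    simp [Matrix.conjTranspose_smul, hPH, hχ]
  have hEE : E * E = E := by
    rw [hE, kraus_measure, smul_mul_smul_comm, mul_add, mul_one, add_mul, one_mul,
      smul_mul_smul_comm, chi_mul_self, hPP, one_smul, add_comm (_ • _) (1 : Op ι), ← two_smul ℂ,
      smul_smul]
    norm_num
  have key : Matrix.trace (Circuit.action (C ++ [StabOp.measure l P]) v ρ) =
      (1 / 2) * Matrix.trace (Circuit.action C v ρ) := by
    rw [Circuit.action, kraus_append, show Circuit.kraus v [StabOp.measure l P] = E from one_mul _,
      Matrix.conjTranspose_mul, hEH, ← mul_assoc, Matrix.trace_mul_comm, mul_assoc E, mul_assoc E,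
      ← mul_assoc E, hEE, hE, kraus_measure, smul_mul_assoc, Matrix.trace_smul, add_mul, one_mul,
      Matrix.trace_add, smul_mul_assoc, Matrix.trace_smul, trace_mul_eq_zero_of_anticomm h hK,
      smul_zero, add_zero, smul_eq_mul]
    rfl
  rw [Circuit.prob, key, Circuit.prob]
  simp [Complex.mul_re]
  ring

end

/-! ### Moving an operator through a product -/

section

variable {ι : Type} [Fintype ι] [DecidableEq ι]

theorem mul_mul_eq_smul_of_commute {A K R : Op ι} {c : ℂ} (h : Commute A K)
    (hR : A * R = c • R) : A * (K * R) = c • (K * R) := by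
  rw [← mul_assoc, h.eq, mul_assoc, hR, mul_smul_comm]

theorem mul_mul_eq_smul_of_left {A K R : Op ι} {c : ℂ} (h : A * K = c • K) :
    A * (K * R) = c • (K * R) := by
  rw [← mul_assoc, h, smul_mul_assoc]

/-- This is how a correction works: the sign from crossing it cancels the sign of the measured
outcome. -/
theorem mul_mul_eq_of_smul_of_smul {A K R : Op ι} {s : ZMod 2} (h : A * K = chi s • (K * A))
    (hR : A * R = chi s • R) : A * (K * R) = K * R := by
  rw [← mul_assoc, h, smul_mul_assoc, mul_assoc, hR, mul_smul_comm, smul_smul, chi_mul_self,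
    one_smul]

theorem mul_mul_eq_of_commute {A K R : Op ι} (h : Commute A K)
    (hR : A * R = R) : A * (K * R) = K * R := by
  rw [← mul_assoc, h.eq, mul_assoc, hR]

end

/-! ## The elements of a common symplectic basis -/

noncomputable instance : DecidableEq Block := Classical.decEq _

noncomputable instance : Fintype Block :=
  ⟨{.delta, .cap, .s, .m, .rest}, fun b => by cases b <;> simp⟩

/-- Names of the elements of a symplectic basis: `(⟨b, j⟩, false)` for `z b j` and
`(⟨b, j⟩, true)` for `x b j`. -/
abbrev Name (d : Block → ℕ) : Type := (Σ b, Fin (d b)) × Bool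

/-- Basis elements with different letters for the same index anticommute, all others commute. -/
noncomputable def pairing {d : Block → ℕ} : Option (Name d) → Option (Name d) → ZMod 2
  | some (i, p), some (j, q) => if i = j ∧ p ≠ q then 1 else 0
  | _, _ => 0

/-- The basis element in the first tensor factor of a generator. -/
def outputPart {d : Block → ℕ} : Name d → Option (Name d)
  | (⟨.delta, j⟩, c) => if c then none else some (⟨.delta, j⟩, true)
  | (⟨.cap, j⟩, c) => if c then none else some (⟨.cap, j⟩, false)
  | (⟨.s, j⟩, c) => if c then none else some (⟨.s, j⟩, false)
  | (⟨.m, j⟩, c) => if c then none else some (⟨.m, j⟩, false)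
  | (⟨.rest, j⟩, c) => some (⟨.rest, j⟩, c)

/-- The basis element whose complex conjugate is in the second tensor factor of a generator. -/
def inputPart {d : Block → ℕ} : Name d → Option (Name d)
  | (⟨.rest, j⟩, c) => some (⟨.rest, j⟩, c)
  | (⟨b, j⟩, c) => if c then some (⟨b, j⟩, false) else none

/-- First tensor factors of operators each of which anticommutes with exactly one generator. -/
def dualOutputPart {d : Block → ℕ} : Name d → Option (Name d)
  | (⟨.delta, j⟩, c) => if c then none else some (⟨.delta, j⟩, false)
  | (⟨.rest, j⟩, c) => some (⟨.rest, j⟩, !c)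
  | (⟨b, j⟩, c) => if c then none else some (⟨b, j⟩, true)

/-- Conjugates of the second tensor factors of operators each of which anticommutes with exactly
one generator. -/
def dualInputPart {d : Block → ℕ} : Name d → Option (Name d)
  | (⟨.rest, _⟩, _) => none
  | (⟨b, j⟩, c) => if c then some (⟨b, j⟩, true) else none

/-- The output parts outside `rest` commute with each other, as do the input parts. Inside `rest`
both tensor factors anticommute together, and the two signs cancel. -/
theorem pairing_parts {d : Block → ℕ} (k l : Name d) :
    pairing (outputPart k) (outputPart l) + pairing (inputPart k) (inputPart l) = 0 := by
  obtain ⟨⟨b, j⟩, c⟩ := k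
  obtain ⟨⟨b', j'⟩, c'⟩ := l
  have h2 : (1 : ZMod 2) + 1 = 0 := rfl
  cases b <;> cases b' <;> cases c <;> cases c' <;>
    simp [outputPart, inputPart, pairing] <;> split_ifs <;> simp [h2]

/-- Outside `rest` the dual is the symplectic partner placed on the same side as the generator's
element. Inside `rest` the partner is placed on the output side only, so that its sign is not
cancelled by the input side. -/
theorem pairing_parts_dual {d : Block → ℕ} (k l : Name d) :
    pairing (outputPart k) (dualOutputPart l) + pairing (inputPart k) (dualInputPart l) =
      if k = l then 1 else 0 := by
  obtain ⟨⟨b, j⟩, c⟩ := k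
  obtain ⟨⟨b', j'⟩, c'⟩ := l
  cases b <;> cases b' <;> cases c <;> cases c' <;>
    simp [outputPart, inputPart, dualOutputPart, dualInputPart, pairing]

namespace CommonSymplecticBasis

variable {n : ℕ} {S M : Subgroup (Un (Fin n))} (B : CommonSymplecticBasis n S M)

theorem card_name : Fintype.card (Name B.d) = Fintype.card (Fin n ⊕ Fin n) := by
  have h : ∑ b, B.d b = n := by
    conv_rhs => rw [← B.sum_d]
    simp [Finset.univ, Fintype.elems, add_assoc]
  simp only [Fintype.card_prod, Fintype.card_sigma, Fintype.card_fin, Fintype.card_bool,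
    Fintype.card_sum, h]
  ring

/-- The basis element with a given name, and the identity in the absence of a name. -/
def elt : Option (Name B.d) → Un (Fin n)
  | none => 1
  | some (⟨b, j⟩, false) => B.z b j
  | some (⟨b, j⟩, true) => B.x b j

theorem elt_mem (u : Option (Name B.d)) : B.elt u ∈ scaledPauliGroup (Fin n) := by
  rcases u with _ | ⟨⟨b, j⟩, _ | _⟩
  exacts [one_mem _, (B.pauli_z b j).mem_scaledPauliGroup, (B.pauli_x b j).mem_scaledPauliGroup]

theorem signComm_x_z (i j : Σ b, Fin (B.d b)) :
    SignComm (if i = j then 1 else 0) (B.x i.1 i.2) (B.z j.1 j.2) := by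
  split_ifs with h
  · subst h
    exact signComm_one_iff.mpr (B.anticomm_xz _ _)
  · exact signComm_zero_iff.mpr (B.comm_xz _ _ _ _ h)

theorem signComm_elt (u w : Option (Name B.d)) :
    SignComm (pairing u w) (B.elt u) (B.elt w) := by
  rcases u with _ | ⟨i, p⟩
  · exact (signComm_one_right _).symm
  rcases w with _ | ⟨j, q⟩
  · exact signComm_one_right _
  cases p <;> cases q
  · simpa [pairing, elt] using signComm_zero_iff.mpr (B.comm_zz i.1 i.2 j.1 j.2)
  · simpa [pairing, elt, eq_comm] using (B.signComm_x_z j i).symm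
  · simpa [pairing, elt] using B.signComm_x_z i j
  · simpa [pairing, elt] using signComm_zero_iff.mpr (B.comm_xx i.1 i.2 j.1 j.2)

/-- The generators of the stabilizer group of the Choi state. -/
noncomputable def generator (vS : LabelS B.d → ZMod 2) (vM : LabelM B.d → ZMod 2) :
    Name B.d → Un (Fin n ⊕ Fin n)
  | (⟨.delta, j⟩, false) => tensor (B.x .delta j) 1
  | (⟨.delta, j⟩, true) => tensor 1 (sgn (vS (.zDelta j)) * conj (B.z .delta j))
  | (⟨.cap, j⟩, false) => tensor (B.z .cap j) (sgn (vS (.zCap j)))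
  | (⟨.cap, j⟩, true) => tensor 1 (sgn (vS (.zCap j)) * conj (B.z .cap j))
  | (⟨.s, j⟩, false) => tensor (B.z .s j) (sgn (vS (.zS j)))
  | (⟨.s, j⟩, true) => tensor 1 (sgn (vS (.zS j)) * conj (B.z .s j))
  | (⟨.m, j⟩, false) => tensor (B.z .m j) 1
  | (⟨.m, j⟩, true) => tensor 1 (sgn (vM (.zM j)) * conj (B.z .m j))
  | (⟨.rest, j⟩, false) => tensor (B.z .rest j) (conj (B.z .rest j))
  | (⟨.rest, j⟩, true) => tensor (B.x .rest j) (conj (B.x .rest j))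

/-- The exponents of the signs of the generators. -/
def generatorSign (vS : LabelS B.d → ZMod 2) (vM : LabelM B.d → ZMod 2) : Name B.d → ZMod 2
  | (⟨.delta, j⟩, true) => vS (.zDelta j)
  | (⟨.cap, j⟩, _) => vS (.zCap j)
  | (⟨.s, j⟩, _) => vS (.zS j)
  | (⟨.m, j⟩, true) => vM (.zM j)
  | _ => 0

theorem range_generator (vS : LabelS B.d → ZMod 2) (vM : LabelM B.d → ZMod 2) :
    Set.range (B.generator vS vM) = B.choiGenerators vS vM := by
  ext P
  constructor
  · rintro ⟨⟨⟨b, j⟩, c⟩, rfl⟩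
    cases b <;> cases c <;> simp [choiGenerators, generator]
  · rintro (((((((((⟨j, rfl⟩ | ⟨j, rfl⟩) | ⟨j, rfl⟩) | ⟨j, rfl⟩) | ⟨j, rfl⟩) | ⟨j, rfl⟩) |
      ⟨j, rfl⟩) | ⟨j, rfl⟩) | ⟨j, rfl⟩) | ⟨j, rfl⟩)
    exacts [⟨(⟨.cap, j⟩, false), rfl⟩, ⟨(⟨.s, j⟩, false), rfl⟩, ⟨(⟨.delta, j⟩, false), rfl⟩,
      ⟨(⟨.m, j⟩, false), rfl⟩, ⟨(⟨.delta, j⟩, true), rfl⟩, ⟨(⟨.cap, j⟩, true), rfl⟩,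
      ⟨(⟨.s, j⟩, true), rfl⟩, ⟨(⟨.m, j⟩, true), rfl⟩, ⟨(⟨.rest, j⟩, true), rfl⟩,
      ⟨(⟨.rest, j⟩, false), rfl⟩]

theorem coe_generator (vS : LabelS B.d → ZMod 2) (vM : LabelM B.d → ZMod 2) (k : Name B.d) :
    (B.generator vS vM k : Op (Fin n ⊕ Fin n)) = chi (B.generatorSign vS vM k) •
      (tensor (B.elt (outputPart k)) (conj (B.elt (inputPart k))) : Op (Fin n ⊕ Fin n)) := by
  have h1 : ((conj (1 : Un (Fin n)) : Un (Fin n)) : Op (Fin n)) = 1 := by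
    simp [conj, Matrix.map_one]
  have h2 : ∀ (c : ℂ) (A D : Op (Fin n)), tensorOp A (c • D) = c • tensorOp A D := fun c A D => by
    have := tensorOp_smul 1 c A D
    rwa [one_smul, one_mul] at this
  obtain ⟨⟨b, j⟩, c⟩ := k
  cases b <;> cases c <;>
    simp [generator, generatorSign, outputPart, inputPart, elt, tensor, h1, h2, coe_sgn]

/-! ## The linear map enacted by the composite circuit -/

section Kraus

variable (vS : LabelS B.d → ZMod 2) (vM : LabelM B.d → ZMod 2)

theorem kraus_circuitS : Circuit.kraus vS B.circuitS =
    Circuit.kraus vS (measureAll .zS (B.z .s) (List.finRange _)) *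
      (Circuit.kraus vS (measureAll .zCap (B.z .cap) (List.finRange _)) *
        Circuit.kraus vS (measureAll .zDelta (B.z .delta) (List.finRange _))) := by
  rw [circuitS, kraus_append, kraus_append]
  rfl

theorem kraus_circuitSM : Circuit.kraus (Sum.elim vS vM) B.circuitSM =
    Circuit.kraus vM (condAll .zM (B.x .m) (List.finRange _)) *
      (Circuit.kraus vM (condAll .xDelta (B.z .delta) (List.finRange _)) *
        (Circuit.kraus vM (measureAll .zM (B.z .m) (List.finRange _)) *
          (Circuit.kraus vM (measureAll .zCap (B.z .cap) (List.finRange _)) *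
            (Circuit.kraus vM (measureAll .xDelta (B.x .delta) (List.finRange _)) *
              Circuit.kraus vS B.circuitS)))) := by
  rw [circuitSM, kraus_seq, circuitM, kraus_append, kraus_append, kraus_append, kraus_append]
  simp only [mul_assoc]
  rfl

variable {B}

theorem comm_zx {b b' : Block} (h : b ≠ b') (j : Fin (B.d b)) (j' : Fin (B.d b')) :
    B.z b j * B.x b' j' = B.x b' j' * B.z b j :=
  (B.comm_xz b' j' b j fun e => h (congrArg Sigma.fst e).symm).symm

variable (hS : IsStabilizerGroup S) (hM : IsStabilizerGroup M)

-- A Pauli unitary may carry a factor `i` and square to `-1`; membership in a stabilizer group is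
-- what makes a measured basis element an involution.
include hS in
theorem z_delta_mul_self (j : Fin (B.d .delta)) : B.z .delta j * B.z .delta j = 1 :=
  (hS.observable _ (B.closure_S.le (Subgroup.subset_closure (.inl (.inl ⟨j, rfl⟩))))).mul_self

include hS in
theorem z_cap_mul_self (j : Fin (B.d .cap)) : B.z .cap j * B.z .cap j = 1 :=
  (hS.observable _ (B.closure_S.le (Subgroup.subset_closure (.inl (.inr ⟨j, rfl⟩))))).mul_self

include hS in
theorem z_s_mul_self (j : Fin (B.d .s)) : B.z .s j * B.z .s j = 1 :=
  (hS.observable _ (B.closure_S.le (Subgroup.subset_closure (.inr ⟨j, rfl⟩)))).mul_self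

include hM in
theorem x_delta_mul_self (j : Fin (B.d .delta)) : B.x .delta j * B.x .delta j = 1 :=
  (hM.observable _ (B.closure_M.le (Subgroup.subset_closure (.inl (.inl ⟨j, rfl⟩))))).mul_self

include hM in
theorem z_m_mul_self (j : Fin (B.d .m)) : B.z .m j * B.z .m j = 1 :=
  (hM.observable _ (B.closure_M.le (Subgroup.subset_closure (.inr ⟨j, rfl⟩)))).mul_self

theorem commute_z_circuitS {b : Block} (j : Fin (B.d b)) :
    Commute (B.z b j : Op (Fin n)) (Circuit.kraus vS B.circuitS) := by
  rw [kraus_circuitS]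
  exact (commute_kraus_measureAll _ fun _ _ => B.comm_zz _ _ _ _).mul_right
    ((commute_kraus_measureAll _ fun _ _ => B.comm_zz _ _ _ _).mul_right
      (commute_kraus_measureAll _ fun _ _ => B.comm_zz _ _ _ _))

theorem commute_x_circuitS {b : Block} (h₁ : b ≠ .delta) (h₂ : b ≠ .cap) (h₃ : b ≠ .s)
    (j : Fin (B.d b)) : Commute (B.x b j : Op (Fin n)) (Circuit.kraus vS B.circuitS) := by
  rw [kraus_circuitS]
  exact (commute_kraus_measureAll _ fun _ _ => (comm_zx h₃.symm _ _).symm).mul_right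
    ((commute_kraus_measureAll _ fun _ _ => (comm_zx h₂.symm _ _).symm).mul_right
      (commute_kraus_measureAll _ fun _ _ => (comm_zx h₁.symm _ _).symm))

include hS in
theorem z_delta_mul_circuitS (j : Fin (B.d .delta)) :
    (B.z .delta j : Op (Fin n)) * Circuit.kraus vS B.circuitS =
      chi (vS (.zDelta j)) • Circuit.kraus vS B.circuitS := by
  rw [kraus_circuitS]
  exact mul_mul_eq_smul_of_commute (commute_kraus_measureAll _ fun _ _ => B.comm_zz _ _ _ _)
    (mul_mul_eq_smul_of_commute (commute_kraus_measureAll _ fun _ _ => B.comm_zz _ _ _ _)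
      (mul_kraus_measureAll (f := LabelS.zDelta) (P := B.z .delta) _ (fun _ _ => B.comm_zz _ _ _ _)
        (z_delta_mul_self hS j)
        (List.mem_finRange j)))

include hS in
theorem z_cap_mul_circuitS (j : Fin (B.d .cap)) :
    (B.z .cap j : Op (Fin n)) * Circuit.kraus vS B.circuitS =
      chi (vS (.zCap j)) • Circuit.kraus vS B.circuitS := by
  rw [kraus_circuitS]
  exact mul_mul_eq_smul_of_commute (commute_kraus_measureAll _ fun _ _ => B.comm_zz _ _ _ _)
    (mul_mul_eq_smul_of_left
      (mul_kraus_measureAll (f := LabelS.zCap) (P := B.z .cap) _ (fun _ _ => B.comm_zz _ _ _ _)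
        (z_cap_mul_self hS j)
        (List.mem_finRange j)))

include hS in
theorem z_s_mul_circuitS (j : Fin (B.d .s)) :
    (B.z .s j : Op (Fin n)) * Circuit.kraus vS B.circuitS =
      chi (vS (.zS j)) • Circuit.kraus vS B.circuitS := by
  rw [kraus_circuitS]
  exact mul_mul_eq_smul_of_left
    (mul_kraus_measureAll (f := LabelS.zS) (P := B.z .s) _ (fun _ _ => B.comm_zz _ _ _ _)
        (z_s_mul_self hS j)
      (List.mem_finRange j))

/-- A basis element `z b j` outside the blocks that the second circuit acts on nontrivially is
absorbed by the composite circuit if it is absorbed by the first. -/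
theorem z_mul_circuitSM {b : Block} (h₁ : b ≠ .delta) (h₂ : b ≠ .m) (j : Fin (B.d b)) {c : ℂ}
    (h : (B.z b j : Op (Fin n)) * Circuit.kraus vS B.circuitS = c • Circuit.kraus vS B.circuitS) :
    (B.z b j : Op (Fin n)) * Circuit.kraus (Sum.elim vS vM) B.circuitSM =
      c • Circuit.kraus (Sum.elim vS vM) B.circuitSM := by
  rw [kraus_circuitSM]
  exact mul_mul_eq_smul_of_commute (commute_kraus_condAll _ fun _ _ => comm_zx h₂ _ _)
    (mul_mul_eq_smul_of_commute (commute_kraus_condAll _ fun _ _ => B.comm_zz _ _ _ _)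
    (mul_mul_eq_smul_of_commute (commute_kraus_measureAll _ fun _ _ => B.comm_zz _ _ _ _)
    (mul_mul_eq_smul_of_commute (commute_kraus_measureAll _ fun _ _ => B.comm_zz _ _ _ _)
    (mul_mul_eq_smul_of_commute (commute_kraus_measureAll _ fun _ _ => comm_zx h₁ _ _) h))))

-- The measurement of `X_Δ j` gives the sign of its outcome, and the correction by `Z_Δ j` gives the
-- same sign again.
include hM in
theorem x_delta_mul_circuitSM (j : Fin (B.d .delta)) :
    (B.x .delta j : Op (Fin n)) * Circuit.kraus (Sum.elim vS vM) B.circuitSM =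
      Circuit.kraus (Sum.elim vS vM) B.circuitSM := by
  rw [kraus_circuitSM]
  exact mul_mul_eq_of_commute (commute_kraus_condAll _ fun _ _ => B.comm_xx _ _ _ _)
    (mul_mul_eq_of_smul_of_smul
      (mul_kraus_condAll (f := LabelM.xDelta) _ (List.nodup_finRange _) (List.mem_finRange j)
        (B.anticomm_xz _ j)
        fun i hi => B.comm_xz _ _ _ _ (by simpa using hi.symm))
    (mul_mul_eq_smul_of_commute
      (commute_kraus_measureAll _ fun _ _ => (comm_zx (by simp) _ _).symm)
    (mul_mul_eq_smul_of_commute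
      (commute_kraus_measureAll _ fun _ _ => (comm_zx (by simp) _ _).symm)
    (mul_mul_eq_smul_of_left
      (mul_kraus_measureAll (f := LabelM.xDelta) (P := B.x .delta) _ (fun _ _ => B.comm_xx _ _ _ _)
        (x_delta_mul_self hM j)
        (List.mem_finRange j))))))

include hM in
theorem z_m_mul_circuitSM (j : Fin (B.d .m)) :
    (B.z .m j : Op (Fin n)) * Circuit.kraus (Sum.elim vS vM) B.circuitSM =
      Circuit.kraus (Sum.elim vS vM) B.circuitSM := by
  rw [kraus_circuitSM]
  exact mul_mul_eq_of_smul_of_smul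
    (mul_kraus_condAll (f := LabelM.zM) _ (List.nodup_finRange _) (List.mem_finRange j)
      (by rw [B.anticomm_xz, neg_neg])
      fun i hi => (B.comm_xz _ _ _ _ (by simpa using hi)).symm)
    (mul_mul_eq_smul_of_commute (commute_kraus_condAll _ fun _ _ => B.comm_zz _ _ _ _)
    (mul_mul_eq_smul_of_left
      (mul_kraus_measureAll (f := LabelM.zM) (P := B.z .m) _ (fun _ _ => B.comm_zz _ _ _ _)
        (z_m_mul_self hM j)
        (List.mem_finRange j))))

/-- An observable that is absorbed by the first circuit is measured by the composite circuit. -/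
theorem circuitSM_mul_z {b : Block} (j : Fin (B.d b)) {c : ℂ}
    (h : (B.z b j : Op (Fin n)) * Circuit.kraus vS B.circuitS = c • Circuit.kraus vS B.circuitS) :
    Circuit.kraus (Sum.elim vS vM) B.circuitSM * (B.z b j : Op (Fin n)) =
      c • Circuit.kraus (Sum.elim vS vM) B.circuitSM := by
  -- The first circuit commutes with `z b j`, so absorption on the left is absorption on the right.
  rw [(commute_z_circuitS vS j).eq] at h
  rw [circuitSM, kraus_seq, mul_assoc, h, mul_smul_comm]

-- `Z_M j` commutes with everything executed before its measurement, so it is measured on the input.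
-- The correction comes later and does not intervene, hence the sign survives here.
include hM in
theorem circuitSM_mul_z_m (j : Fin (B.d .m)) :
    Circuit.kraus (Sum.elim vS vM) B.circuitSM * (B.z .m j : Op (Fin n)) =
      chi (vM (.zM j)) • Circuit.kraus (Sum.elim vS vM) B.circuitSM := by
  have h₁ := kraus_measureAll_mul (f := LabelM.zM) vM (fun i j => B.comm_zz .m i .m j)
    (z_m_mul_self hM j) (List.mem_finRange j)
  have h₂ : Commute (B.z .m j : Op (Fin n))
      (Circuit.kraus vM (measureAll .zCap (B.z .cap) (List.finRange _))) :=
    commute_kraus_measureAll _ fun _ _ => B.comm_zz _ _ _ _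
  have h₃ : Commute (B.z .m j : Op (Fin n))
      (Circuit.kraus vM (measureAll .xDelta (B.x .delta) (List.finRange _))) :=
    commute_kraus_measureAll _ fun _ _ => comm_zx (by simp) _ _
  rw [kraus_circuitSM]
  simp only [mul_assoc]
  rw [← (commute_z_circuitS vS j).eq, ← mul_assoc _ (B.z .m j : Op (Fin n)), ← h₃.eq, mul_assoc,
    ← mul_assoc _ (B.z .m j : Op (Fin n)), ← h₂.eq, mul_assoc,
    ← mul_assoc _ (B.z .m j : Op (Fin n)), h₁]
  simp only [smul_mul_assoc, mul_smul_comm]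

theorem commute_z_rest (j : Fin (B.d .rest)) :
    Commute (B.z .rest j : Op (Fin n)) (Circuit.kraus (Sum.elim vS vM) B.circuitSM) := by
  rw [kraus_circuitSM]
  exact (commute_kraus_condAll _ fun _ _ => comm_zx (by simp) _ _).mul_right
    ((commute_kraus_condAll _ fun _ _ => B.comm_zz _ _ _ _).mul_right
    ((commute_kraus_measureAll _ fun _ _ => B.comm_zz _ _ _ _).mul_right
    ((commute_kraus_measureAll _ fun _ _ => B.comm_zz _ _ _ _).mul_right
    ((commute_kraus_measureAll _ fun _ _ => comm_zx (by simp) _ _).mul_right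
    (commute_z_circuitS vS j)))))

theorem commute_x_rest (j : Fin (B.d .rest)) :
    Commute (B.x .rest j : Op (Fin n)) (Circuit.kraus (Sum.elim vS vM) B.circuitSM) := by
  rw [kraus_circuitSM]
  exact (commute_kraus_condAll _ fun _ _ => B.comm_xx _ _ _ _).mul_right
    ((commute_kraus_condAll _ fun _ _ => (comm_zx (by simp) _ _).symm).mul_right
    ((commute_kraus_measureAll _ fun _ _ => (comm_zx (by simp) _ _).symm).mul_right
    ((commute_kraus_measureAll _ fun _ _ => (comm_zx (by simp) _ _).symm).mul_right
    ((commute_kraus_measureAll _ fun _ _ => B.comm_xx _ _ _ _).mul_right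
    (commute_x_circuitS vS (by simp) (by simp) (by simp) j)))))

include hS hM in
theorem generator_mulVec_choiState (k : Name B.d) :
    (B.generator vS vM k : Op (Fin n ⊕ Fin n)) *ᵥ
      Circuit.choiState B.circuitSM (Sum.elim vS vM) =
      Circuit.choiState B.circuitSM (Sum.elim vS vM) := by
  rw [coe_generator, Circuit.choiState, Matrix.smul_mulVec, tensor_conj_mulVec,
    ← Matrix.smul_mulVec, ← tensorOp_smul_left]
  congr 2
  have absorb : ∀ {s : ZMod 2} {A K : Op (Fin n)}, A = chi s • K → chi s • A = K := by
    rintro s A K rfl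
    rw [smul_smul, chi_mul_self, one_smul]
  -- Only unitarity is needed: any phase of `P` cancels in `P ⊗ P*`.
  have preserve : ∀ {P : Un (Fin n)} {K : Op (Fin n)}, Commute (P : Op (Fin n)) K →
      (P : Op (Fin n)) * K * (P : Op (Fin n))ᴴ = K := fun h => by
    rw [h.eq, mul_assoc, mul_conjTranspose_self, mul_one]
  obtain ⟨⟨b, j⟩, c⟩ := k
  cases b <;> cases c <;>
    simp only [generatorSign, outputPart, inputPart, elt, if_true, Bool.false_eq_true, if_false,
      OneMemClass.coe_one, Matrix.conjTranspose_one, mul_one, one_mul, chi_zero, one_smul]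
  · exact x_delta_mul_circuitSM vS vM hM j
  · rw [conjTranspose_eq_self (z_delta_mul_self hS j)]
    exact absorb (circuitSM_mul_z vS vM j (z_delta_mul_circuitS vS hS j))
  · exact absorb (z_mul_circuitSM vS vM (by simp) (by simp) j (z_cap_mul_circuitS vS hS j))
  · rw [conjTranspose_eq_self (z_cap_mul_self hS j)]
    exact absorb (circuitSM_mul_z vS vM j (z_cap_mul_circuitS vS hS j))
  · exact absorb (z_mul_circuitSM vS vM (by simp) (by simp) j (z_s_mul_circuitS vS hS j))
  · rw [conjTranspose_eq_self (z_s_mul_self hS j)]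
    exact absorb (circuitSM_mul_z vS vM j (z_s_mul_circuitS vS hS j))
  · exact z_m_mul_circuitSM vS vM hM j
  · rw [conjTranspose_eq_self (z_m_mul_self hM j)]
    exact absorb (circuitSM_mul_z_m vS vM hM j)
  · exact preserve (commute_z_rest vS vM j)
  · exact preserve (commute_x_rest vS vM j)

include hS hM in
/-- The generators generate the stabilizer group of the Choi state. -/
theorem closure_choiGenerators (h : Circuit.kraus (Sum.elim vS vM) B.circuitSM ≠ 0) :
    (Subgroup.closure (B.choiGenerators vS vM) : Set (Un (Fin n ⊕ Fin n))) =
      stabilizers (Circuit.choiState B.circuitSM (Sum.elim vS vM)) := by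
  -- Signs add over the two tensor factors, and conjugation preserves them; commutation is thereby
  -- reduced to `pairing`.
  have sc : ∀ u w u' w' : Option (Name B.d), SignComm (pairing u u' + pairing w w')
      (tensor (B.elt u) (conj (B.elt w))) (tensor (B.elt u') (conj (B.elt w'))) :=
    fun u w u' w' => (B.signComm_elt u u').tensor (B.signComm_elt w w').conj
  have mem : ∀ u w : Option (Name B.d),
      tensor (B.elt u) (conj (B.elt w)) ∈ scaledPauliGroup (Fin n ⊕ Fin n) :=
    fun u w => tensor_mem_scaledPauliGroup (B.elt_mem u) (conj_mem_scaledPauliGroup (B.elt_mem w))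
  have gen := B.coe_generator vS vM
  rw [← range_generator]
  refine closure_eq_stabilizers
    (h := fun k => tensor (B.elt (dualOutputPart k)) (conj (B.elt (dualInputPart k))))
    B.card_name (fun k => ?_) (fun k => mem _ _) (fun k l => ?_) (fun k l => ?_)
    (tensorOp_one_mulVec_bell_ne_zero h) (generator_mulVec_choiState vS vM hS hM)
  · obtain ⟨c, p, hp⟩ := mem (outputPart k) (inputPart k)
    exact ⟨_, p, by rw [gen, hp, smul_smul]⟩
  · have := sc (outputPart k) (inputPart k) (outputPart l) (inputPart l)
    rw [pairing_parts] at this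
    exact this.of_smul (gen k) (gen l)
  · have := sc (outputPart k) (inputPart k) (dualOutputPart l) (dualInputPart l)
    rw [pairing_parts_dual] at this
    exact this.of_smul (gen k) (one_smul ℂ _).symm

/-! ## Independence of the random outcomes -/

include hS in
/-- Up to a sign, the linear map enacted by the composite circuit can be computed as if all the
outcomes of `X_Δ` were zero and no corrections were needed. -/
theorem exists_kraus_circuitSM_eq_smul : ∃ c, Circuit.kraus (Sum.elim vS vM) B.circuitSM = chi c •
    (Circuit.kraus vM (condAll .zM (B.x .m) (List.finRange _)) *
      (Circuit.kraus vM (measureAll .zM (B.z .m) (List.finRange _)) *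
        (Circuit.kraus vM (measureAll .zCap (B.z .cap) (List.finRange _)) *
          (Circuit.kraus 0 (measureAll LabelM.xDelta (B.x .delta) (List.finRange _)) *
            Circuit.kraus vS B.circuitS)))) := by
  -- Directly after the first circuit every `Z_Δ j` acts as a sign, so the corrections contribute
  -- only `chi c`.
  obtain ⟨c, hc⟩ := kraus_condAll_mul (f := LabelM.xDelta) (js := List.finRange _) vM
    (z_delta_mul_circuitS vS hS)
  refine ⟨c, ?_⟩
  have h₁ := commute_condAll_measureAll (f := LabelM.xDelta) (f' := LabelM.zM)
    (js := List.finRange _) (js' := List.finRange _) vM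
    fun i j => B.comm_zz .delta i .m j
  have h₂ := commute_condAll_measureAll (f := LabelM.xDelta) (f' := LabelM.zCap)
    (js := List.finRange _) (js' := List.finRange _) vM
    fun i j => B.comm_zz .delta i .cap j
  have h₃ := kraus_condAll_mul_measureAll (f := LabelM.xDelta) (js := List.finRange _) vM 0
    (List.nodup_finRange _) (fun _ => rfl) (B.anticomm_xz .delta)
    fun i j hij => B.comm_xz .delta j .delta i (by simpa using hij.symm)
  -- The corrections by `Z_Δ` move right past the measurements of `Z_M` and `Z_∩`, then through
  -- those of `X_Δ`, whose outcomes become zero, and are absorbed by the first circuit.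
  rw [kraus_circuitSM, ← mul_assoc (Circuit.kraus vM (condAll .xDelta _ _)), h₁.eq, mul_assoc,
    ← mul_assoc (Circuit.kraus vM (condAll .xDelta _ _)), h₂.eq, mul_assoc,
    ← mul_assoc (Circuit.kraus vM (condAll .xDelta _ _)), h₃, mul_assoc, hc]
  simp only [mul_smul_comm]

include hS in
theorem exists_kraus_eq_smul {vM' : LabelM B.d → ZMod 2}
    (hcap : ∀ j, vM (.zCap j) = vM' (.zCap j)) (hm : ∀ j, vM (.zM j) = vM' (.zM j)) :
    ∃ c, Circuit.kraus (Sum.elim vS vM) B.circuitSM =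
      chi c • Circuit.kraus (Sum.elim vS vM') B.circuitSM := by
  obtain ⟨c, hc⟩ := exists_kraus_circuitSM_eq_smul (B := B) vS vM hS
  obtain ⟨c', hc'⟩ := exists_kraus_circuitSM_eq_smul (B := B) vS vM' hS
  -- Both maps are signs times the same operator, and a sign is its own inverse.
  refine ⟨c + c', ?_⟩
  rw [hc, hc', smul_smul, chi_add, mul_assoc, chi_mul_self, mul_one, kraus_condAll_congr hm,
    kraus_measureAll_congr hcap, kraus_measureAll_congr hm]

-- The first circuit measures `Z_Δ j`, and the measurements of `X_Δ i` executed before that of `X_Δ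
-- j` commute with it. So the eigenvalue relation required by `prob_append_measure` holds just
-- before `X_Δ j` is measured.
include hS hM in
theorem isRandomOutcome_xDelta (j : Fin (B.d .delta)) :
    Circuit.IsRandomOutcome B.circuitSM (Sum.inr (.xDelta j)) := by
  obtain ⟨as, bs, h⟩ := List.append_of_mem (List.mem_finRange j)
  have hj : j ∉ as := fun hm =>
    (List.nodup_append.mp (h ▸ List.nodup_finRange _)).2.2 j hm j List.mem_cons_self rfl
  refine ⟨B.circuitS.seq (measureAll LabelM.xDelta (B.x .delta) as),
    (measureAll LabelM.xDelta (B.x .delta) bs ++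
      measureAll LabelM.zCap (B.z .cap) (List.finRange _) ++
      measureAll LabelM.zM (B.z .m) (List.finRange _) ++
      condAll LabelM.xDelta (B.z .delta) (List.finRange _) ++
      condAll LabelM.zM (B.x .m) (List.finRange _)).map (StabOp.relabel Function.Embedding.inr),
    B.x .delta j, ?_, fun ρ v _ hv => ?_⟩
  · have hΔ : (List.finRange (B.d .delta)).map
        (fun j => StabOp.measure (LabelM.xDelta j) (B.x .delta j)) =
        measureAll LabelM.xDelta (B.x .delta) as ++
          StabOp.measure (.xDelta j) (B.x .delta j) :: measureAll LabelM.xDelta (B.x .delta) bs := by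
      rw [h]; exact List.map_append
    rw [circuitSM, circuitM, hΔ]
    simp only [Circuit.seq, List.map_append, List.append_assoc, List.map_cons, List.cons_append]
    rfl
  · have hK : (B.z .delta j : Op (Fin n)) * Circuit.kraus v
        (B.circuitS.seq (measureAll LabelM.xDelta (B.x .delta) as)) =
        chi (v (Sum.inl (.zDelta j))) • Circuit.kraus v
          (B.circuitS.seq (measureAll LabelM.xDelta (B.x .delta) as)) := by
      rw [← Sum.elim_comp_inl_inr v, kraus_seq]
      exact mul_mul_eq_smul_of_commute
        (commute_kraus_measureAll _ fun i hi =>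
          (B.comm_xz _ _ _ _ fun e => hj (by simp at e; exact e ▸ hi)).symm)
        (z_delta_mul_circuitS _ hS j)
    rw [prob_append_measure (x_delta_mul_self hM j) (B.anticomm_xz _ j) hK, div_right_comm,
      div_self hv]

end Kraus

end CommonSymplecticBasis

end StabChoi

theorem mainTheorem6 (n : ℕ)
    (S M : Subgroup (StabChoi.Un (Fin n)))
    (hS : StabChoi.IsStabilizerGroup S) (hM : StabChoi.IsStabilizerGroup M)
    (B : StabChoi.CommonSymplecticBasis n S M) :
    -- the stabilizers of the Choi state, for every outcome vector that can occur
    (∀ (vS : StabChoi.LabelS B.d → ZMod 2) (vM : StabChoi.LabelM B.d → ZMod 2),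
      StabChoi.Circuit.kraus (Sum.elim vS vM) B.circuitSM ≠ 0 →
        (Subgroup.closure (B.choiGenerators vS vM) : Set (StabChoi.Un (Fin n ⊕ Fin n))) =
          StabChoi.stabilizers (StabChoi.Circuit.choiState B.circuitSM (Sum.elim vS vM))) ∧
    -- the action and the signs do not depend on the outcomes of `X_Δ`
    (∀ (vS : StabChoi.LabelS B.d → ZMod 2) (vM vM' : StabChoi.LabelM B.d → ZMod 2),
      (∀ j, vM (.zCap j) = vM' (.zCap j)) → (∀ j, vM (.zM j) = vM' (.zM j)) →
        (∀ ρ : StabChoi.Op (Fin n),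
          StabChoi.Circuit.action B.circuitSM (Sum.elim vS vM) ρ =
            StabChoi.Circuit.action B.circuitSM (Sum.elim vS vM') ρ) ∧
        B.choiGenerators vS vM = B.choiGenerators vS vM' ∧
        StabChoi.stabilizers (StabChoi.Circuit.choiState B.circuitSM (Sum.elim vS vM)) =
          StabChoi.stabilizers (StabChoi.Circuit.choiState B.circuitSM (Sum.elim vS vM'))) ∧
    -- the outcomes of `X_Δ` are random
    (∀ j, StabChoi.Circuit.IsRandomOutcome B.circuitSM (Sum.inr (.xDelta j))) := by
  refine ⟨fun vS vM h => StabChoi.CommonSymplecticBasis.closure_choiGenerators vS vM hS hM h,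
    fun vS vM vM' hcap hm => ?_,
    fun j => StabChoi.CommonSymplecticBasis.isRandomOutcome_xDelta hS hM j⟩
  obtain ⟨c, hc⟩ := StabChoi.CommonSymplecticBasis.exists_kraus_eq_smul vS vM hS hcap hm
  have hstar : star (StabChoi.chi c) = StabChoi.chi c := by
    rcases StabChoi.zmod_two_cases c with rfl | rfl <;> simp
  have hne : StabChoi.chi c ≠ 0 := left_ne_zero_of_mul_eq_one (StabChoi.chi_mul_self c)
  refine ⟨fun ρ => ?_, ?_, ?_⟩
  -- The sign occurs once in the map and once in its adjoint.
  · rw [StabChoi.Circuit.action, StabChoi.Circuit.action, hc, Matrix.conjTranspose_smul, hstar,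
      smul_mul_assoc, smul_mul_smul_comm, StabChoi.chi_mul_self, one_smul]
  · simp only [StabChoi.CommonSymplecticBasis.choiGenerators, hm]
  · rw [StabChoi.Circuit.choiState, StabChoi.Circuit.choiState, hc, StabChoi.tensorOp_smul_left,
      Matrix.smul_mulVec, StabChoi.stabilizers_smul _ hne]
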